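/- Let $d\in\mathbb N=\{1,2,\dots\}$. For a set $\mathcal P=\{x_1,\dots,x_N\}\subseteq[0,1]^d$ of $N$ points let $$\Delta_{\mathcal P}(t)=\frac{\#\{j\in\{1,\dots,N\}:x_j\in[0,t)\}}{N}-\mathrm{Vol}([0,t]),\qquad t\in[0,1]^d,$$ where $[0,t)=[0,t_1)\times\cdots\times[0,t_d)$ and $\mathrm{Vol}$ is the $d$-dimensional Lebesgue measure, and let $\Delta_\emptyset(t)=-\mathrm{Vol}([0,t])$. For $\alpha\in[1,\infty)$ put $\psi_\alpha(x)=\exp(x^\alpha)-1$ and, for measurable $f:[0,1]^d\to\mathbb R$, $$\|f\|_{\psi_\alpha}=\inf\Big\{K>0:\int_{[0,1]^d}\psi_\alpha\Big(\frac{|f(x)|}{K}\Big)\,dx\le 1\Big\}.$$ Let $\mathrm{disc}_{\psi_\alpha}(N,d)=\inf\{\|\Delta_{\mathcal P}\|_{\psi_\alpha}:\mathcal P\subseteq[0,1]^d,\ |\mathcal P|=N\}$ and, for $\varepsilon\in(0,1)$, $$N_{\psi_\alpha}(\varepsilon,d)=\min\{N\in\mathbb N:\mathrm{disc}_{\psi_\alpha}(N,d)\le\varepsilon\,\|\Delta_\emptyset\|_{\psi_\alpha}\}.$$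 The discrepancy with respect to $\|\cdot\|_{\psi_\alpha}$ is called polynomially tractable if there are $C,\tau,\sigma\in(0,\infty)$ such that $N_{\psi_\alpha}(\varepsilon,d)\le C\,d^{\tau}\varepsilon^{-\sigma}$ for all $\varepsilon\in(0,1)$ and all $d\in\mathbb N$; the infimum of all $\tau\in(0,\infty)$ for which such a bound holds (with some $C,\sigma\in(0,\infty)$) is called the $d$-exponent of polynomial tractability. **Theorem.** For every $\alpha\in[1,\infty)$, every $\varepsilon\in(0,1)$ and every $d\in\mathbb N$, the minimum defining $N_{\psi_\alpha}(\varepsilon,d)$ exists and $$N_{\psi_\alpha}(\varepsilon,d)\le\Big\lceil C_\alpha\,d^{\max\{1,2/\alpha\}}\,(\log(d+1))^{2/\alpha}\,\varepsilon^{-2}\Big\rceil,\qquad C_\alpha=2601\cdot\alpha^{2/\alpha}\cdot\Big(\frac{\sqrt{2\pi}}{e^{11/12}}\Big)^{2/\alpha},$$ where $\log$ is the natural logarithm. In particular, the discrepancy with respect to $\|\cdot\|_{\psi_\alpha}$ is polynomially tractable, and its $d$-exponent of polynomial tractability is at most $\max\{1,2/\alpha\}$. -/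

import Mathlib

open MeasureTheory
open scoped ENNReal

noncomputable section

namespace OrliczDiscrepancy

/-- The local discrepancy function of the points `x 0, …, x (N - 1)` of `[0,1]^d`:
`Δ(t) = #{j : x_j ∈ [0, t)} / N - Vol([0, t])`, with
`[0, t) = [0, t_1) × ⋯ × [0, t_d)`. (Only its values at `t ∈ [0,1]^d` matter.) -/
def localDiscrepancy {N d : ℕ} (x : Fin N → Fin d → ℝ) (t : Fin d → ℝ) : ℝ :=
  (Nat.card {j : Fin N // x j ∈ Set.univ.pi fun i => Set.Ico (0 : ℝ) (t i)} : ℝ) / (N : ℝ)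
    - (volume (Set.Icc (0 : Fin d → ℝ) t)).toReal

/-- The local discrepancy function of the empty point set: `Δ_∅(t) = - Vol([0, t])`. -/
def emptyLocalDiscrepancy (d : ℕ) (t : Fin d → ℝ) : ℝ :=
  -(volume (Set.Icc (0 : Fin d → ℝ) t)).toReal

/-- A functional on functions on `[0,1]^d` for every dimension `d`, with values in `[0, ∞]`. -/
abbrev NormFamily : Type := (d : ℕ) → ((Fin d → ℝ) → ℝ) → ℝ≥0∞

/-- The `N`-th minimal discrepancy `disc(N, d)`: the infimum of the discrepancies of all sets of
`N` distinct points of `[0,1]^d`. -/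
def minimalDiscrepancy (nrm : NormFamily) (N d : ℕ) : ℝ≥0∞ :=
  ⨅ (x : Fin N → Fin d → ℝ) (_ : Function.Injective x) (_ : ∀ j, x j ∈ Set.Icc 0 1),
    nrm d (localDiscrepancy x)

/-- The inverse of the minimal discrepancy: the smallest `N ∈ {1, 2, …}` with
`disc(N, d) ≤ ε ‖Δ_∅‖` (and `∞` if there is none). -/
def inverseDiscrepancy (nrm : NormFamily) (ε : ℝ) (d : ℕ) : ℕ∞ :=
  ⨅ (N : ℕ) (_ : 1 ≤ N)
    (_ : minimalDiscrepancy nrm N d ≤ ENNReal.ofReal ε * nrm d (emptyLocalDiscrepancy d)), (N : ℕ∞)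

/-- `τ` is an admissible `d`-exponent: there are `C, σ ∈ (0, ∞)` with
`N(ε, d) ≤ C d^τ ε^{-σ}` for all `ε ∈ (0, 1)` and all `d ∈ {1, 2, …}`. -/
def IsAdmissibleExponent (nrm : NormFamily) (τ : ℝ) : Prop :=
  ∃ C > (0 : ℝ), ∃ σ > (0 : ℝ), ∀ ε : ℝ, 0 < ε → ε < 1 → ∀ d : ℕ, 1 ≤ d →
    ((inverseDiscrepancy nrm ε d : ℕ∞) : ℝ≥0∞)
      ≤ ENNReal.ofReal (C * (d : ℝ) ^ τ * ε ^ (-σ))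

/-- The discrepancy is polynomially tractable if some `τ ∈ (0, ∞)` is admissible. -/
def IsPolynomiallyTractable (nrm : NormFamily) : Prop :=
  ∃ τ > (0 : ℝ), IsAdmissibleExponent nrm τ

/-- The `d`-exponent of polynomial tractability: the infimum of all admissible `τ ∈ (0, ∞)`
(and `∞` if there is none). -/
def dExponent (nrm : NormFamily) : ℝ≥0∞ :=
  ⨅ (τ : ℝ) (_ : 0 < τ) (_ : IsAdmissibleExponent nrm τ), ENNReal.ofReal τ

/-- `ψ_α(x) = exp(x^α) - 1`, for `x ≥ 0`. -/
def psi (α x : ℝ) : ℝ := Real.exp (x ^ α) - 1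

/-- The exponential Orlicz (Luxemburg) norm
`‖f‖_{ψ_α} = inf {K > 0 : ∫_{[0,1]^d} ψ_α(|f(x)| / K) dx ≤ 1}`
(and `∞` if there is no such `K`). -/
def psiNorm (α : ℝ) : NormFamily := fun d f =>
  ⨅ (K : ℝ) (_ : 0 < K)
    (_ : ∫⁻ x in Set.Icc (0 : Fin d → ℝ) 1, ENNReal.ofReal (psi α (|f x| / K)) ≤ 1),
    ENNReal.ofReal K

/-- `C_α = 2601 · α^{2/α} · (√(2π) / e^{11/12})^{2/α}`. -/
def constC (α : ℝ) : ℝ :=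
  2601 * α ^ (2 / α) * (Real.sqrt (2 * Real.pi) / Real.exp (11 / 12)) ^ (2 / α)

end OrliczDiscrepancy

end

/-! The proof is probabilistic: N independent uniform points satisfy, with positive probability, two
bounds at once. The first is uniform, |Δ| ≤ 51 √(d/N) on the cube (`measure_exists_dev_box_gt_le`);
the second is an averaged sub-Gaussian bound, ∫ exp(NΔ²/11) ≤ 9/5
(`measure_lintegral_exp_dev_sq_ge_le`). Their failure probabilities are at most 1/4 and 7/10.

The uniform bound has no logarithmic loss because of chaining. In logarithmic coordinates the volume
of a box depends only on a coordinate sum, so a grid of mesh 1/(2^k d) approximates boxes up to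
volume 2^{-k}; boxes of volume below about e^{-k} are replaced by ∅, which leaves at most e^{d(k+3)}
grid points. Bernstein's inequality with variance 2^{-k} beats this count at deviations of order √(d
k / (N 2^k)), and these are summable in k. The averaged bound needs no union bound: a fixed box has
sub-Gaussian deviation, and Tonelli integrates over all boxes, so the dimension does not enter.

The initial discrepancy is bounded below by its values near the corner (1,…,1): its norm is at least
a constant times (α d log(d+1))^{-1/α} (`rpow_ge_of_lintegral_psi_le`). Let κ be ε times this bound;
it remains to dominate (|Δ|/κ)^α by (1 + NΔ²)/11. For α ≤ 2 this holds once Nκ² ≥ 121, which gives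
the exponent 2/α of d. For α ≥ 2 one writes |Δ|^α = Δ² |Δ|^{α-2} and applies the uniform bound to
the second factor; one factor d cancels against κ^α and the exponent becomes 1. -/

namespace OrliczDiscrepancy

/-! ### Boxes in the unit cube and the deviation of point counts -/

/-- Lebesgue measure on the unit cube. -/
noncomputable def cubeMeasure (d : ℕ) : Measure (Fin d → ℝ) := volume.restrict (Set.Icc 0 1)

instance (d : ℕ) : IsProbabilityMeasure (cubeMeasure d) := by
  constructor
  simp [cubeMeasure, ← Set.pi_univ_Icc, volume_pi_pi]

/-- The half-open box `[0, t)`. -/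
def box {d : ℕ} (t : Fin d → ℝ) : Set (Fin d → ℝ) := Set.univ.pi fun i => Set.Ico (0 : ℝ) (t i)

theorem measurableSet_box {d : ℕ} (t : Fin d → ℝ) : MeasurableSet (box t) :=
  MeasurableSet.univ_pi fun _ => measurableSet_Ico

theorem box_subset_box {d : ℕ} {s t : Fin d → ℝ} (h : ∀ i, s i ≤ t i) : box s ⊆ box t :=
  Set.pi_mono fun i _ => Set.Ico_subset_Ico_right (h i)

theorem cubeMeasure_real_box {d : ℕ} {t : Fin d → ℝ} (h0 : ∀ i, 0 ≤ t i) (h1 : ∀ i, t i ≤ 1) :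
    (cubeMeasure d).real (box t) = ∏ i, t i := by
  have hsub : box t ⊆ Set.Icc 0 1 := by
    intro y hy
    exact ⟨fun i => (hy i trivial).1, fun i => (hy i trivial).2.le.trans (h1 i)⟩
  rw [Measure.real, cubeMeasure, Measure.restrict_apply (measurableSet_box t),
    Set.inter_eq_left.2 hsub, box, volume_pi_pi]
  simp [ENNReal.toReal_prod, ENNReal.toReal_ofReal, h0]

/-- The unnormalised deviation of the number of points in `A` from its mean. -/
noncomputable def dev {N d : ℕ} (x : Fin N → Fin d → ℝ) (A : Set (Fin d → ℝ)) : ℝ :=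
  ∑ j, (A.indicator 1 (x j) - (cubeMeasure d).real A)

theorem volume_Icc_zero_toReal {d : ℕ} {t : Fin d → ℝ} (h0 : ∀ i, 0 ≤ t i) :
    (volume (Set.Icc (0 : Fin d → ℝ) t)).toReal = ∏ i, t i := by
  rw [← Set.pi_univ_Icc, volume_pi_pi]
  simp [ENNReal.toReal_prod, ENNReal.toReal_ofReal, h0]

theorem localDiscrepancy_eq {N d : ℕ} (hN : 0 < N) (x : Fin N → Fin d → ℝ) {t : Fin d → ℝ}
    (h0 : ∀ i, 0 ≤ t i) (h1 : ∀ i, t i ≤ 1) :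
    localDiscrepancy x t = dev x (box t) / N := by
  classical
  have hN' : (N : ℝ) ≠ 0 := by positivity
  have hc : (Nat.card {j : Fin N // x j ∈ Set.univ.pi fun i => Set.Ico (0 : ℝ) (t i)} : ℝ)
      = ∑ j, (box t).indicator 1 (x j) := by
    rw [Nat.card_eq_fintype_card, Fintype.card_subtype, Finset.card_filter]
    push_cast
    exact Finset.sum_congr rfl fun j _ => by simp only [box, Set.indicator_apply, Pi.one_apply]
  rw [localDiscrepancy, hc, volume_Icc_zero_toReal h0, dev, Finset.sum_sub_distrib,
    cubeMeasure_real_box h0 h1]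
  simp only [Finset.sum_const, Finset.card_univ, Fintype.card_fin, nsmul_eq_mul]
  field_simp

theorem dev_empty {N d : ℕ} (x : Fin N → Fin d → ℝ) : dev x ∅ = 0 := by simp [dev]

theorem dev_sdiff_add {N d : ℕ} (x : Fin N → Fin d → ℝ) {A B : Set (Fin d → ℝ)}
    (hB : MeasurableSet B) (h : B ⊆ A) : dev x (A \ B) + dev x B = dev x A := by
  rw [dev, dev, dev, ← Finset.sum_add_distrib]
  refine Finset.sum_congr rfl fun j _ => ?_
  have : (A \ B).indicator (1 : (Fin d → ℝ) → ℝ) (x j) + B.indicator 1 (x j)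
      = A.indicator 1 (x j) := by
    by_cases h1 : x j ∈ B
    · simp [h1, h h1]
    · by_cases h2 : x j ∈ A <;> simp [h1, h2]
  rw [measureReal_sdiff h hB, ← this]
  ring

/-- The count is monotone in the set, so only the difference of the means is lost. Used on both
sides, this brackets a general box between grid boxes. -/
theorem dev_le_dev_add {N d : ℕ} (x : Fin N → Fin d → ℝ) {A B : Set (Fin d → ℝ)} (h : A ⊆ B) :
    dev x A ≤ dev x B + N * ((cubeMeasure d).real B - (cubeMeasure d).real A) := by
  have : (N : ℝ) * ((cubeMeasure d).real B - (cubeMeasure d).real A)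
      = ∑ _j : Fin N, ((cubeMeasure d).real B - (cubeMeasure d).real A) := by simp [mul_sub]
  rw [this, dev, dev, ← Finset.sum_add_distrib]
  refine Finset.sum_le_sum fun j _ => ?_
  have : A.indicator (1 : (Fin d → ℝ) → ℝ) (x j) ≤ B.indicator 1 (x j) :=
    Set.indicator_le_indicator_of_subset h (fun _ => zero_le_one) _
  linarith

/-! ### The dyadic exponential grid -/

/-- The grid point with coordinates `exp (-c i / (2 ^ k * d))`. -/
noncomputable def gridPoint {d : ℕ} (k : ℕ) (c : Fin d → ℕ) : Fin d → ℝ :=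
  fun i => Real.exp (-((c i : ℝ) / (2 ^ k * d)))

/-- The bound on the coordinate sum of the grid points used at level `k`. -/
def gridBound (d k : ℕ) : ℕ := d * 2 ^ k * (k + 2)

/-- The predecessor, in the chain of boxes, of the box of a grid point. -/
def prevBox {d : ℕ} : ℕ → (Fin d → ℕ) → Set (Fin d → ℝ)
  | 0, _ => ∅
  | k + 1, c =>
    if ∑ i, (c i + 1) / 2 ≤ gridBound d k then box (gridPoint k fun i => (c i + 1) / 2) else ∅

theorem gridPoint_pos {d : ℕ} (k : ℕ) (c : Fin d → ℕ) (i : Fin d) : 0 ≤ gridPoint k c i :=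
  (Real.exp_pos _).le

theorem gridPoint_le_one {d : ℕ} (k : ℕ) (c : Fin d → ℕ) (i : Fin d) : gridPoint k c i ≤ 1 := by
  rw [gridPoint, Real.exp_le_one_iff]
  have : (0 : ℝ) ≤ (c i : ℝ) / (2 ^ k * d) := by positivity
  linarith

theorem measurableSet_prevBox {d : ℕ} (k : ℕ) (c : Fin d → ℕ) : MeasurableSet (prevBox k c) := by
  cases k with
  | zero => exact MeasurableSet.empty
  | succ k =>
    rw [prevBox]
    split_ifs
    · exact measurableSet_box _
    · exact MeasurableSet.empty

theorem prod_gridPoint {d : ℕ} (k : ℕ) (c : Fin d → ℕ) :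
    ∏ i, gridPoint k c i = Real.exp (-((∑ i, c i : ℕ) : ℝ) / (2 ^ k * d)) := by
  simp only [gridPoint]
  rw [← Real.exp_sum]
  congr 1
  push_cast
  rw [neg_div, Finset.sum_div, Finset.sum_neg_distrib]

theorem measure_box_gridPoint {d : ℕ} (k : ℕ) (c : Fin d → ℕ) :
    (cubeMeasure d).real (box (gridPoint k c))
      = Real.exp (-((∑ i, c i : ℕ) : ℝ) / (2 ^ k * d)) := by
  rw [cubeMeasure_real_box (gridPoint_pos k c) (gridPoint_le_one k c), prod_gridPoint]

theorem prevBox_subset {d : ℕ} (k : ℕ) (c : Fin d → ℕ) : prevBox k c ⊆ box (gridPoint k c) := by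
  cases k with
  | zero => exact Set.empty_subset _
  | succ k =>
    rw [prevBox]
    split_ifs
    · refine box_subset_box fun i => Real.exp_le_exp.2 (neg_le_neg ?_)
      have hd : (0 : ℝ) < d := by exact_mod_cast Fin.pos i
      have h2 : (c i : ℝ) ≤ 2 * ((c i + 1) / 2 : ℕ) := by
        exact_mod_cast (by omega : c i ≤ 2 * ((c i + 1) / 2))
      rw [div_le_div_iff₀ (by positivity) (by positivity), pow_succ]
      nlinarith [mul_le_mul_of_nonneg_right h2 (by positivity : (0 : ℝ) ≤ 2 ^ k * d)]
    · exact Set.empty_subset _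

theorem exp_neg_le_two_inv_pow (k : ℕ) : Real.exp (-(k : ℝ)) ≤ (2 ^ k)⁻¹ := by
  rw [Real.exp_neg]
  refine inv_anti₀ (by positivity) ?_
  rw [← Real.exp_one_pow]
  exact pow_le_pow_left₀ (by norm_num) (by linarith [Real.add_one_le_exp (1 : ℝ)]) k

/-- Rounding `c` up to even entries adds at most d to the coordinate sum, hence at most 1/2^(k+1) to
minus the logarithm of the volume at level k+1. This is the variance used at each chaining step. -/
theorem measure_box_diff_prevBox_le {d : ℕ} (hd : 0 < d) (k : ℕ) (c : Fin d → ℕ) :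
    (cubeMeasure d).real (box (gridPoint k c) \ prevBox k c) ≤ (2 ^ k)⁻¹ := by
  have hd' : (0 : ℝ) < d := by exact_mod_cast hd
  cases k with
  | zero => simp
  | succ k =>
    rw [measureReal_sdiff (prevBox_subset _ _) (measurableSet_prevBox _ _), measure_box_gridPoint,
      prevBox]
    set m := ∑ i, (c i + 1) / 2 with hm
    have hlow : 2 * m ≤ (∑ i, c i) + d := by
      calc 2 * m = ∑ i, 2 * ((c i + 1) / 2) := by rw [hm, Finset.mul_sum]
        _ ≤ ∑ i, (c i + 1) := Finset.sum_le_sum fun i _ => by omega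
        _ = (∑ i, c i) + d := by rw [Finset.sum_add_distrib]; simp
    have hlow' : 2 * (m : ℝ) ≤ ((∑ i, c i : ℕ) : ℝ) + d := by exact_mod_cast hlow
    generalize hn : ((∑ i, c i : ℕ) : ℝ) = n at *
    have hn0 : 0 ≤ n := by rw [← hn]; positivity
    split_ifs with h
    · rw [measure_box_gridPoint, ← hm]
      have h1 : Real.exp (-n / (2 ^ (k + 1) * d)) ≤ 1 := by
        rw [Real.exp_le_one_iff]
        have : 0 ≤ n / (2 ^ (k + 1) * d) := by positivity
        rw [neg_div]; linarith
      have h2 : -(m : ℝ) / (2 ^ k * d) = -n / (2 ^ (k + 1) * d) + -(2 * m - n) / (2 ^ (k + 1) * d) := by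
        field_simp
        ring
      have h3 : (2 * m - n) / (2 ^ (k + 1) * d) ≤ ((2 : ℝ) ^ (k + 1))⁻¹ := by
        rw [div_le_iff₀ (by positivity), ← mul_assoc, inv_mul_cancel₀ (by positivity)]
        linarith
      rw [h2, Real.exp_add]
      have h4 := Real.add_one_le_exp (-(2 * m - n) / (2 ^ (k + 1) * d))
      rw [neg_div] at h4
      rw [neg_div (2 ^ (k + 1) * (d : ℝ)) (2 * (m : ℝ) - n)]
      have h5 : 0 < ((2 : ℝ) ^ (k + 1))⁻¹ := by positivity
      nlinarith [Real.exp_pos (-n / (2 ^ (k + 1) * d))]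
    -- A parent outside the grid has m > d 2^k (k+2), so n ≥ 2m - d ≥ 2^(k+1) d (k+1): the whole box
    -- has volume at most e^{-(k+1)}.
    · rw [measureReal_empty, sub_zero]
      refine le_trans (Real.exp_le_exp.2 ?_) (exp_neg_le_two_inv_pow (k + 1))
      have h' : (d : ℝ) * 2 ^ k * (k + 2) ≤ m := by
        have := (not_le.1 h).le
        rw [gridBound] at this
        exact_mod_cast this
      rw [div_le_iff₀ (by positivity)]
      have h1 : (1 : ℝ) ≤ 2 ^ k := one_le_pow₀ (by norm_num)
      push_cast
      rw [pow_succ]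
      nlinarith

/-- Chaining: control of all increments gives control of all boxes of grid points. -/
theorem abs_dev_gridPoint_le {N d K : ℕ} (x : Fin N → Fin d → ℝ) (s : ℕ → ℝ)
    (h : ∀ k ≤ K, ∀ c : Fin d → ℕ, ∑ i, c i ≤ gridBound d k →
      |dev x (box (gridPoint k c) \ prevBox k c)| ≤ s k) (k : ℕ) (hk : k ≤ K) (c : Fin d → ℕ)
    (hc : ∑ i, c i ≤ gridBound d k) :
    |dev x (box (gridPoint k c))| ≤ ∑ j ∈ Finset.range (k + 1), s j := by
  have hs : ∀ k ≤ K, 0 ≤ s k := fun k hk => (abs_nonneg _).trans (h k hk 0 (by simp))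
  induction k generalizing c with
  | zero => simpa [prevBox] using h 0 hk c hc
  | succ k ih =>
    rw [Finset.sum_range_succ, ← dev_sdiff_add x (measurableSet_prevBox _ _) (prevBox_subset _ c)]
    have h1 := h (k + 1) hk c hc
    have h2 : |dev x (prevBox (k + 1) c)| ≤ ∑ j ∈ Finset.range (k + 1), s j := by
      rw [prevBox]
      split_ifs with h'
      · exact ih (by omega) _ h'
      · rw [dev_empty, abs_zero]
        exact Finset.sum_nonneg fun j hj => hs j (by have := Finset.mem_range.1 hj; omega)
    exact (abs_add_le _ _).trans (by linarith)

/-- Rounding the logarithms down and up moves each coordinate by a factor exp(-1/(2^K d)), so the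
two volumes differ by the factor exp(-2^{-K}). -/
theorem exists_gridPoint_bracket {d K : ℕ} (hd : 0 < d) {t : Fin d → ℝ} (h0 : ∀ i, 0 < t i)
    (h1 : ∀ i, t i ≤ 1) (ht : ∑ i, -Real.log (t i) ≤ K + 1) :
    ∃ c c' : Fin d → ℕ, ∑ i, c i ≤ gridBound d K ∧ ∑ i, c' i ≤ gridBound d K ∧
      (∀ i, gridPoint K c i ≤ t i) ∧ (∀ i, t i ≤ gridPoint K c' i) ∧
      ∏ i, gridPoint K c' i - ∏ i, gridPoint K c i ≤ (2 ^ K)⁻¹ := by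
  have hd' : (0 : ℝ) < d := by exact_mod_cast hd
  have hm : (0 : ℝ) < 2 ^ K * d := by positivity
  set f : Fin d → ℕ := fun i => ⌊-Real.log (t i) * (2 ^ K * d)⌋₊ with hf
  have hy : ∀ i, 0 ≤ -Real.log (t i) * (2 ^ K * d) := fun i =>
    mul_nonneg (neg_nonneg.2 (Real.log_nonpos (h0 i).le (h1 i))) hm.le
  -- Rounding up costs one unit per coordinate, d in all; the gap between K+1 and the K+2 in
  -- `gridBound` leaves room for it.
  have hsum : ∑ i, (f i + 1) ≤ gridBound d K := by
    have h2 : ((∑ i, (f i + 1) : ℕ) : ℝ) ≤ (K + 1) * (2 ^ K * d) + d := by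
      push_cast
      rw [Finset.sum_add_distrib]
      refine add_le_add ?_ (by simp)
      refine le_trans (Finset.sum_le_sum fun i _ => Nat.floor_le (hy i)) ?_
      rw [← Finset.sum_mul]
      exact mul_le_mul_of_nonneg_right ht hm.le
    have h3 : (1 : ℝ) ≤ 2 ^ K := one_le_pow₀ (by norm_num)
    have h4 : ((∑ i, (f i + 1) : ℕ) : ℝ) ≤ (gridBound d K : ℕ) := by
      refine h2.trans ?_
      rw [gridBound]
      push_cast
      nlinarith
    exact_mod_cast h4
  refine ⟨fun i => f i + 1, f, hsum, (Finset.sum_le_sum fun i _ => Nat.le_succ _).trans hsum,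
    fun i => ?_, fun i => ?_, ?_⟩
  · rw [gridPoint, ← Real.le_log_iff_exp_le (h0 i)]
    have := (Nat.lt_floor_add_one (-Real.log (t i) * (2 ^ K * d))).le
    rw [neg_le, le_div_iff₀ hm]
    push_cast
    exact this
  · rw [gridPoint, ← Real.log_le_iff_le_exp (h0 i), le_neg, div_le_iff₀ hm]
    exact Nat.floor_le (hy i)
  · rw [prod_gridPoint, prod_gridPoint]
    have h2 : -((∑ i, (f i + 1) : ℕ) : ℝ) / (2 ^ K * d)
        = -((∑ i, f i : ℕ) : ℝ) / (2 ^ K * d) + -(2 ^ K)⁻¹ := by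
      push_cast
      rw [Finset.sum_add_distrib]
      simp
      field_simp
      ring
    rw [h2, Real.exp_add]
    have h4 := Real.add_one_le_exp (-(2 ^ K : ℝ)⁻¹)
    have h5 : 0 < ((2 : ℝ) ^ K)⁻¹ := by positivity
    have h6 : Real.exp (-((∑ i, f i : ℕ) : ℝ) / (2 ^ K * d)) ≤ 1 := by
      rw [Real.exp_le_one_iff, neg_div, neg_nonpos]
      positivity
    nlinarith [Real.exp_pos (-((∑ i, f i : ℕ) : ℝ) / (2 ^ K * d))]

theorem abs_dev_box_le_of_sum_log_le {N d K : ℕ} (hd : 0 < d) (x : Fin N → Fin d → ℝ) {S : ℝ}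
    (h : ∀ c : Fin d → ℕ, ∑ i, c i ≤ gridBound d K → |dev x (box (gridPoint K c))| ≤ S)
    {t : Fin d → ℝ} (h0 : ∀ i, 0 < t i) (h1 : ∀ i, t i ≤ 1)
    (ht : ∑ i, -Real.log (t i) ≤ K + 1) :
    |dev x (box t)| ≤ S + N * (2 ^ K)⁻¹ := by
  obtain ⟨c, c', hc, hc', hct, htc, hv⟩ := exists_gridPoint_bracket hd h0 h1 ht
  have ha := abs_le.1 (h c hc)
  have hb := abs_le.1 (h c' hc')
  have hlo := dev_le_dev_add x (box_subset_box hct)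
  have hup := dev_le_dev_add x (box_subset_box htc)
  rw [cubeMeasure_real_box (fun i => (h0 i).le) h1,
    cubeMeasure_real_box (gridPoint_pos _ _) (gridPoint_le_one _ _)] at hlo hup
  have hm1 : ∏ i, gridPoint K c i ≤ ∏ i, t i :=
    Finset.prod_le_prod (fun i _ => gridPoint_pos _ _ i) fun i _ => hct i
  have hm2 : ∏ i, t i ≤ ∏ i, gridPoint K c' i :=
    Finset.prod_le_prod (fun i _ => (h0 i).le) fun i _ => htc i
  have hN : (0 : ℝ) ≤ N := Nat.cast_nonneg N
  rw [abs_le]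
  constructor <;> nlinarith

/-- Control of the boxes of grid points gives control of all boxes in the unit cube. -/
theorem abs_dev_box_le {N d K : ℕ} (hd : 0 < d) (x : Fin N → Fin d → ℝ) {S : ℝ}
    (h : ∀ c : Fin d → ℕ, ∑ i, c i ≤ gridBound d K → |dev x (box (gridPoint K c))| ≤ S)
    {t : Fin d → ℝ} (h0 : ∀ i, 0 ≤ t i) (h1 : ∀ i, t i ≤ 1) :
    |dev x (box t)| ≤ S + N * (2 * (2 ^ K)⁻¹) := by
  have hN : (0 : ℝ) ≤ N := Nat.cast_nonneg N
  have h5 : 0 < ((2 : ℝ) ^ K)⁻¹ := by positivity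
  have hS : 0 ≤ S := (abs_nonneg _).trans (h 0 (by simp))
  have hN5 : 0 ≤ (N : ℝ) * (2 ^ K)⁻¹ := by positivity
  by_cases hpos : ∀ i, 0 < t i
  swap
  · push Not at hpos
    obtain ⟨i, hi⟩ := hpos
    have : box t = ∅ := by
      refine Set.univ_pi_eq_empty (i := i) ?_
      exact Set.Ico_eq_empty (not_lt.2 hi)
    rw [this, dev_empty, abs_zero]
    positivity
  by_cases ht : ∑ i, -Real.log (t i) ≤ K + 1
  · have := abs_dev_box_le_of_sum_log_le hd x h hpos h1 ht
    linarith
  push Not at ht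
  set y : ℝ := ∑ i, -Real.log (t i) with hy
  have hy0 : 0 < y := lt_of_le_of_lt (by positivity) ht
  -- A box too small for the grid is enlarged to t^θ, whose volume is exactly e^{-(K+1)}. Its volume
  -- is at most 2^{-K}, so the enlargement costs a second term N 2^{-K}.
  set θ : ℝ := (K + 1) / y with hθ
  have hθ0 : 0 ≤ θ := by positivity
  have hθ1 : θ ≤ 1 := (div_le_one hy0).2 ht.le
  set t' : Fin d → ℝ := fun i => Real.exp (θ * Real.log (t i)) with ht'
  have hlog : ∀ i, Real.log (t i) ≤ 0 := fun i => Real.log_nonpos (h0 i) (h1 i)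
  have htt : ∀ i, t i ≤ t' i := fun i => by
    rw [ht', ← Real.log_le_iff_le_exp (hpos i)]
    nlinarith [hlog i]
  have ht'1 : ∀ i, t' i ≤ 1 := fun i => by
    rw [ht', Real.exp_le_one_iff]
    exact mul_nonpos_of_nonneg_of_nonpos hθ0 (hlog i)
  have hsum : ∑ i, -Real.log (t' i) = K + 1 := by
    simp only [ht', Real.log_exp]
    rw [Finset.sum_neg_distrib, ← Finset.mul_sum, ← mul_neg, ← Finset.sum_neg_distrib, ← hy, hθ]
    field_simp
  have hprod : ∀ u : Fin d → ℝ, (∀ i, 0 < u i) → ∏ i, u i = Real.exp (-∑ i, -Real.log (u i)) := by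
    intro u hu
    rw [Finset.sum_neg_distrib, neg_neg, Real.exp_sum]
    exact Finset.prod_congr rfl fun i _ => (Real.exp_log (hu i)).symm
  have hvol : ∏ i, t' i ≤ (2 ^ K)⁻¹ := by
    rw [hprod t' fun i => Real.exp_pos _, hsum]
    refine le_trans (Real.exp_le_exp.2 ?_) (exp_neg_le_two_inv_pow K)
    linarith
  have hvol2 : ∏ i, t i ≤ ∏ i, t' i := Finset.prod_le_prod (fun i _ => h0 i) fun i _ => htt i
  have hvol0 : 0 ≤ ∏ i, t i := Finset.prod_nonneg fun i _ => h0 i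
  have ha := abs_le.1 (abs_dev_box_le_of_sum_log_le hd x h (fun i => Real.exp_pos _) ht'1 hsum.le)
  have hup := dev_le_dev_add x (box_subset_box htt)
  have hlo := dev_le_dev_add x (Set.empty_subset (box t))
  rw [dev_empty, measureReal_empty] at hlo
  rw [cubeMeasure_real_box (fun i => (Real.exp_pos _).le) ht'1] at hup
  rw [cubeMeasure_real_box h0 h1] at hup hlo
  rw [abs_le]
  constructor <;> nlinarith

/-! ### Random points -/

/-- The law of `N` independent uniformly distributed points of the unit cube. -/
noncomputable def sampleMeasure (N d : ℕ) : Measure (Fin N → Fin d → ℝ) :=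
  Measure.pi fun _ => cubeMeasure d

instance (N d : ℕ) : IsProbabilityMeasure (sampleMeasure N d) := by
  unfold sampleMeasure
  infer_instance

theorem measurable_dev {N d : ℕ} {A : Set (Fin d → ℝ)} (hA : MeasurableSet A) :
    Measurable fun x : Fin N → Fin d → ℝ => dev x A := by
  unfold dev
  refine Finset.measurable_sum _ fun j _ => Measurable.sub_const ?_ _
  exact (measurable_one.indicator hA).comp (measurable_pi_apply j)

theorem exp_mul_indicator_sub {d : ℕ} (A : Set (Fin d → ℝ)) (l a : ℝ) (y : Fin d → ℝ) :
    Real.exp (l * (A.indicator 1 y - a))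
      = Real.exp (-(l * a)) * (1 + A.indicator 1 y * (Real.exp l - 1)) := by
  by_cases h : y ∈ A
  · simp only [h, Set.indicator_of_mem, Pi.one_apply, one_mul, add_sub_cancel, ← Real.exp_add]
    ring_nf
  · simp [h]

theorem integral_exp_mul_indicator_sub {d : ℕ} {A : Set (Fin d → ℝ)} (hA : MeasurableSet A)
    (l : ℝ) :
    ∫ y, Real.exp (l * (A.indicator 1 y - (cubeMeasure d).real A)) ∂cubeMeasure d
      = Real.exp (-(l * (cubeMeasure d).real A))
        * (1 + (cubeMeasure d).real A * (Real.exp l - 1)) := by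
  simp only [exp_mul_indicator_sub]
  have hi : Integrable (fun y => A.indicator (1 : (Fin d → ℝ) → ℝ) y) (cubeMeasure d) :=
    (integrable_const (1 : ℝ)).indicator hA
  rw [integral_const_mul, integral_add (integrable_const _) (hi.mul_const _), integral_mul_const,
    integral_indicator_one hA]
  simp

theorem integral_exp_mul_indicator_sub_le {d : ℕ} {A : Set (Fin d → ℝ)} (hA : MeasurableSet A)
    {l : ℝ} (hl : |l| ≤ 1) :
    ∫ y, Real.exp (l * (A.indicator 1 y - (cubeMeasure d).real A)) ∂cubeMeasure d
      ≤ Real.exp ((cubeMeasure d).real A * l ^ 2) := by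
  rw [integral_exp_mul_indicator_sub hA]
  set a := (cubeMeasure d).real A
  have ha : 0 ≤ a := measureReal_nonneg
  have h1 := (abs_le.1 (Real.abs_exp_sub_one_sub_id_le hl)).2
  calc Real.exp (-(l * a)) * (1 + a * (Real.exp l - 1))
      ≤ Real.exp (-(l * a)) * Real.exp (a * (Real.exp l - 1)) := by
        gcongr
        linarith [Real.add_one_le_exp (a * (Real.exp l - 1))]
    _ = Real.exp (a * (Real.exp l - 1 - l)) := by rw [← Real.exp_add]; ring_nf
    _ ≤ Real.exp (a * l ^ 2) := Real.exp_le_exp.2 (mul_le_mul_of_nonneg_left h1 ha)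

/-- For |l| ≥ 1 the centred indicator is at most 1 in absolute value and |l| ≤ l². The range of l is
unrestricted because l later becomes a Gaussian variable. -/
theorem integral_exp_mul_indicator_sub_le_exp_sq {d : ℕ} {A : Set (Fin d → ℝ)}
    (hA : MeasurableSet A) (l : ℝ) :
    ∫ y, Real.exp (l * (A.indicator 1 y - (cubeMeasure d).real A)) ∂cubeMeasure d
      ≤ Real.exp (l ^ 2) := by
  have ha : 0 ≤ (cubeMeasure d).real A := measureReal_nonneg
  have ha1 : (cubeMeasure d).real A ≤ 1 := measureReal_le_one
  rcases le_total |l| 1 with hl | hl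
  · refine (integral_exp_mul_indicator_sub_le hA hl).trans (Real.exp_le_exp.2 ?_)
    exact mul_le_of_le_one_left (sq_nonneg l) ha1
  · have hb : ∀ y, Real.exp (l * (A.indicator 1 y - (cubeMeasure d).real A))
        ≤ Real.exp (l ^ 2) := by
      intro y
      refine Real.exp_le_exp.2 ?_
      have h1 : |A.indicator (1 : (Fin d → ℝ) → ℝ) y - (cubeMeasure d).real A| ≤ 1 := by
        rw [abs_le]
        by_cases h : y ∈ A <;> simp only [h, Set.indicator_of_mem, Set.indicator_of_notMem,
          not_false_eq_true, Pi.one_apply] <;> constructor <;> linarith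
      calc _ ≤ |l * (A.indicator 1 y - (cubeMeasure d).real A)| := le_abs_self _
        _ = |l| * |A.indicator 1 y - (cubeMeasure d).real A| := abs_mul _ _
        _ ≤ |l| * |l| := mul_le_mul_of_nonneg_left (h1.trans hl) (abs_nonneg l)
        _ = l ^ 2 := by rw [abs_mul_abs_self, sq]
    refine (integral_mono_of_nonneg (Filter.Eventually.of_forall fun y => (Real.exp_pos _).le)
      (integrable_const (Real.exp (l ^ 2))) (Filter.Eventually.of_forall hb)).trans ?_
    simp

theorem lintegral_exp_mul_dev_le {N d : ℕ} {A : Set (Fin d → ℝ)} (hA : MeasurableSet A)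
    {l b : ℝ} (hb : ∫ y, Real.exp (l * (A.indicator 1 y - (cubeMeasure d).real A)) ∂cubeMeasure d
      ≤ Real.exp b) :
    ∫⁻ x, ENNReal.ofReal (Real.exp (l * dev x A)) ∂sampleMeasure N d
      ≤ ENNReal.ofReal (Real.exp (N * b)) := by
  have hexp : ∀ x : Fin N → Fin d → ℝ, Real.exp (l * dev x A)
      = ∏ j, Real.exp (l * (A.indicator 1 (x j) - (cubeMeasure d).real A)) := by
    intro x
    rw [dev, Finset.mul_sum, Real.exp_sum]
  have hint1 : Integrable (fun y => Real.exp (l * (A.indicator 1 y - (cubeMeasure d).real A)))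
      (cubeMeasure d) := by
    simp only [exp_mul_indicator_sub]
    have hi : Integrable (fun y => A.indicator (1 : (Fin d → ℝ) → ℝ) y) (cubeMeasure d) :=
      (integrable_const (1 : ℝ)).indicator hA
    exact ((integrable_const _).add (hi.mul_const _)).const_mul _
  have hint : Integrable (fun x : Fin N → Fin d → ℝ => Real.exp (l * dev x A))
      (sampleMeasure N d) := by
    simp only [hexp]
    exact Integrable.fintype_prod fun _ => hint1
  rw [← ofReal_integral_eq_lintegral_ofReal hint
    (Filter.Eventually.of_forall fun x => (Real.exp_pos _).le)]
  refine ENNReal.ofReal_le_ofReal ?_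
  simp only [hexp]
  rw [sampleMeasure, integral_fintype_prod_eq_pow (ι := Fin N)
    (fun y => Real.exp (l * (A.indicator 1 y - (cubeMeasure d).real A))), Fintype.card_fin,
    Real.exp_nat_mul]
  exact pow_le_pow_left₀ (integral_nonneg fun y => (Real.exp_pos _).le) hb N

/-- One-sided Chernoff bound. -/
theorem measure_le_mul_dev_le {N d : ℕ} {A : Set (Fin d → ℝ)} (hA : MeasurableSet A) {v l : ℝ}
    (hv : (cubeMeasure d).real A ≤ v) (hl : |l| ≤ 1) (r : ℝ) :
    sampleMeasure N d {x | r ≤ l * dev x A}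
      ≤ ENNReal.ofReal (Real.exp (N * (v * l ^ 2) - r)) := by
  have hb := (integral_exp_mul_indicator_sub_le hA hl).trans (Real.exp_le_exp.2
    (mul_le_mul_of_nonneg_right hv (sq_nonneg l)))
  have h1 := lintegral_exp_mul_dev_le (N := N) hA hb
  have hmeas : AEMeasurable (fun x : Fin N → Fin d → ℝ => ENNReal.ofReal (Real.exp (l * dev x A)))
      (sampleMeasure N d) :=
    (Real.measurable_exp.comp ((measurable_dev hA).const_mul l)).ennreal_ofReal.aemeasurable
  have h2 := mul_meas_ge_le_lintegral₀ hmeas (ENNReal.ofReal (Real.exp r))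
  have hset : {x : Fin N → Fin d → ℝ | r ≤ l * dev x A}
      = {x | ENNReal.ofReal (Real.exp r) ≤ ENNReal.ofReal (Real.exp (l * dev x A))} := by
    ext x
    simp only [Set.mem_ofPred_eq]
    rw [ENNReal.ofReal_le_ofReal_iff (Real.exp_pos _).le, Real.exp_le_exp]
  rw [hset, Real.exp_sub, ENNReal.ofReal_div_of_pos (Real.exp_pos r),
    ENNReal.le_div_iff_mul_le (Or.inl (by simp [Real.exp_pos])) (Or.inl ENNReal.ofReal_ne_top),
    mul_comm]
  exact h2.trans h1

/-- Two-sided deviation bound of Bernstein type. -/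
theorem measure_abs_dev_ge_le {N d : ℕ} {A : Set (Fin d → ℝ)} (hA : MeasurableSet A) {v s : ℝ}
    (hv0 : 0 < v) (hv : (cubeMeasure d).real A ≤ v) (hs0 : 0 ≤ s) (hs : s ≤ 2 * v) :
    sampleMeasure N d {x | N * s ≤ |dev x A|}
      ≤ 2 * ENNReal.ofReal (Real.exp (-(N * s ^ 2 / (4 * v)))) := by
  -- Minimiser of N v l² - l N s; the hypothesis s ≤ 2v is what keeps it in the range |l| ≤ 1 of the
  -- exponential estimate.
  set l := s / (2 * v) with hl
  have hl0 : 0 ≤ l := by positivity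
  have hl1 : l ≤ 1 := (div_le_one (by positivity)).2 hs
  have hexp : N * (v * l ^ 2) - l * (N * s) = -(N * s ^ 2 / (4 * v)) := by
    rw [hl]
    field_simp
    ring
  have h1 := measure_le_mul_dev_le (N := N) hA hv (abs_le.2 ⟨by linarith, hl1⟩) (l * (N * s))
  have h2 := measure_le_mul_dev_le (N := N) hA hv (l := -l) (abs_le.2 ⟨by linarith, by linarith⟩)
    (l * (N * s))
  rw [neg_sq] at h2
  rw [hexp] at h1 h2
  have hsub : {x : Fin N → Fin d → ℝ | N * s ≤ |dev x A|}
      ⊆ {x | l * (N * s) ≤ l * dev x A} ∪ {x | l * (N * s) ≤ -l * dev x A} := by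
    intro x hx
    rcases le_abs.1 (show (N : ℝ) * s ≤ |dev x A| from hx) with h | h
    · exact Or.inl (mul_le_mul_of_nonneg_left h hl0)
    · refine Or.inr ?_
      have := mul_le_mul_of_nonneg_left h hl0
      simp only [Set.mem_ofPred_eq]
      linarith
  rw [two_mul]
  exact (measure_mono hsub).trans ((measure_union_le _ _).trans (add_le_add h1 h2))

/-! ### Counting grid points -/

/-- The grid points of bounded coordinate sum. -/
def gridFinset (d m : ℕ) : Finset (Fin d → ℕ) :=
  (Fintype.piFinset fun _ => Finset.range (m + 1)).filter fun c => ∑ i, c i ≤ m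

theorem mem_gridFinset {d m : ℕ} {c : Fin d → ℕ} : c ∈ gridFinset d m ↔ ∑ i, c i ≤ m := by
  rw [gridFinset, Finset.mem_filter, Fintype.mem_piFinset, and_iff_right_iff_imp]
  intro h i
  rw [Finset.mem_range, Nat.lt_succ_iff]
  exact (Finset.single_le_sum (fun j _ => Nat.zero_le (c j)) (Finset.mem_univ i)).trans h

/-- Exponential weights: each counted point has weight exp(l(m - ∑ c i)) ≥ 1, and the sum of the
weights over the full product factors into d geometric sums, each at most 1/(1 - e^{-l}) ≤ 1 + 1/l.
-/
theorem card_gridFinset_le {d m : ℕ} {l : ℝ} (hl : 0 < l) :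
    ((gridFinset d m).card : ℝ) ≤ Real.exp (l * m) * (1 + 1 / l) ^ d := by
  have hq1 : Real.exp (-l) < 1 := by rw [Real.exp_lt_one_iff]; linarith
  have hgeom : ∑ j ∈ Finset.range (m + 1), Real.exp (-l) ^ j ≤ 1 + 1 / l := by
    refine (Summable.sum_le_tsum _ (fun j _ => by positivity)
      (summable_geometric_of_lt_one (Real.exp_pos _).le hq1)).trans ?_
    rw [tsum_geometric_of_lt_one (Real.exp_pos _).le hq1, inv_le_comm₀ (by linarith) (by positivity)]
    have h1 : Real.exp (-l) ≤ 1 / (1 + l) := by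
      rw [Real.exp_neg, one_div]
      exact inv_anti₀ (by positivity) (by linarith [Real.add_one_le_exp l])
    have h2 : (1 + 1 / l)⁻¹ = 1 - 1 / (1 + l) := by
      field_simp
      ring
    linarith
  calc ((gridFinset d m).card : ℝ)
      = ∑ c ∈ gridFinset d m, 1 := by simp
    _ ≤ ∑ c ∈ gridFinset d m, Real.exp (l * m) * ∏ i, Real.exp (-l) ^ c i := by
        refine Finset.sum_le_sum fun c hc => ?_
        rw [Finset.prod_pow_eq_pow_sum, ← Real.exp_nat_mul, ← Real.exp_add, Real.one_le_exp_iff]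
        have : ((∑ i, c i : ℕ) : ℝ) ≤ m := by exact_mod_cast mem_gridFinset.1 hc
        nlinarith
    _ ≤ ∑ c ∈ Fintype.piFinset fun _ : Fin d => Finset.range (m + 1),
          Real.exp (l * m) * ∏ i, Real.exp (-l) ^ c i :=
        Finset.sum_le_sum_of_subset_of_nonneg (Finset.filter_subset _ _)
          fun c _ _ => by positivity
    _ = Real.exp (l * m) * (∑ j ∈ Finset.range (m + 1), Real.exp (-l) ^ j) ^ d := by
        rw [← Finset.mul_sum, ← Finset.prod_univ_sum]
        simp
    _ ≤ _ := by gcongr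

theorem card_gridFinset_gridBound_le {d : ℕ} (hd : 0 < d) (k : ℕ) :
    ((gridFinset d (gridBound d k)).card : ℝ) ≤ Real.exp (d * (k + 3)) := by
  have hd' : (0 : ℝ) < d := by exact_mod_cast hd
  -- With this l the exponent l · `gridBound d k` is exactly d, and 1 + 1/l ≤ e^{k+2}.
  have hl : (0 : ℝ) < 1 / (2 ^ k * (k + 2)) := by positivity
  have hk : ∀ k : ℕ, (1 : ℝ) + 2 ^ k * (k + 2) ≤ Real.exp (k + 2) := by
    intro k
    induction k with
    | zero =>
      have := Real.quadratic_le_exp_of_nonneg (x := 2) (by norm_num)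
      norm_num at this ⊢
      linarith
    | succ k ih =>
      have h1 : Real.exp ((k + 1 : ℕ) + 2) = Real.exp (k + 2) * Real.exp 1 := by
        rw [← Real.exp_add]; push_cast; ring_nf
      have he : (2.7 : ℝ) ≤ Real.exp 1 := by linarith [Real.exp_one_gt_d9]
      have h2 : (1 : ℝ) ≤ 2 ^ k := one_le_pow₀ (by norm_num)
      rw [h1]
      have h3 : (1 + 2 ^ k * ((k : ℝ) + 2)) * 2.7 ≤ Real.exp (k + 2) * Real.exp 1 :=
        mul_le_mul ih he (by norm_num) (Real.exp_pos _).le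
      refine le_trans ?_ h3
      push_cast
      rw [pow_succ]
      rcases Nat.eq_zero_or_pos k with rfl | hk
      · norm_num
      · have : (1 : ℝ) ≤ k := by exact_mod_cast hk
        nlinarith
  refine (card_gridFinset_le hl).trans ?_
  have h1 : 1 / (2 ^ k * ((k : ℝ) + 2)) * (gridBound d k : ℕ) = d := by
    rw [gridBound]
    push_cast
    field_simp
  have h2 : Real.exp (d * (k + 3)) = Real.exp d * Real.exp (k + 2) ^ d := by
    rw [← Real.exp_nat_mul, ← Real.exp_add]
    ring_nf
  rw [h1, h2, one_div_one_div]
  gcongr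
  exact hk k

/-! ### Random points are almost surely distinct points of the cube -/

theorem sampleMeasure_eq_restrict (N d : ℕ) :
    sampleMeasure N d = (volume : Measure (Fin N → Fin d → ℝ)).restrict
      (Set.univ.pi fun _ => Set.Icc 0 1) := by
  rw [sampleMeasure, volume_pi, Measure.restrict_pi_pi]
  rfl

theorem ae_sampleMeasure_mem_Icc (N d : ℕ) :
    ∀ᵐ x ∂sampleMeasure N d, ∀ j, x j ∈ Set.Icc (0 : Fin d → ℝ) 1 := by
  rw [sampleMeasure_eq_restrict]
  filter_upwards [ae_restrict_mem (MeasurableSet.univ_pi fun _ => measurableSet_Icc)] with x hx j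
  exact hx j trivial

/-- A coincidence of two points puts the sample into the hyperplane on which their first coordinates
agree, a Lebesgue null set. -/
theorem ae_sampleMeasure_injective (N : ℕ) {d : ℕ} (hd : 0 < d) :
    ∀ᵐ x ∂sampleMeasure N d, Function.Injective x := by
  have h : ∀ i j : Fin N, i ≠ j → ∀ᵐ x ∂sampleMeasure N d, x i ≠ x j := by
    intro i j hij
    let φ : (Fin N → Fin d → ℝ) →ₗ[ℝ] ℝ :=
      LinearMap.proj (⟨0, hd⟩ : Fin d) ∘ₗ
        ((LinearMap.proj i : (Fin N → Fin d → ℝ) →ₗ[ℝ] (Fin d → ℝ)) - LinearMap.proj j)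
    have hφ : LinearMap.ker φ ≠ ⊤ := by
      intro h
      have h1 : φ (Function.update 0 i 1) = 0 := by
        rw [LinearMap.ker_eq_top.1 h]; rfl
      simp [φ, Function.update_of_ne hij.symm] at h1
    have h0 := Measure.addHaar_submodule volume (LinearMap.ker φ) hφ
    rw [sampleMeasure_eq_restrict]
    refine ae_restrict_of_ae ?_
    rw [ae_iff]
    refine measure_mono_null (fun x hx => ?_) h0
    have hx' : x i = x j := by simpa using hx
    simp [φ, hx']
  have h2 : ∀ᵐ x ∂sampleMeasure N d, ∀ i j : Fin N, i ≠ j → x i ≠ x j := by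
    refine ae_all_iff.2 fun i => ae_all_iff.2 fun j => ?_
    by_cases hij : i = j
    · simp [hij]
    · filter_upwards [h i j hij] with x hx _ using hx
  filter_upwards [h2] with x hx i j hij
  by_contra hne
  exact hx i j hne hij

/-! ### The uniform bound -/

/-- The deviation allowed for the increments of the chain of boxes at level `k`. -/
noncomputable def chainScale (σ : ℝ) (k : ℕ) : ℝ := 2 * σ * √((2 * k + 6) / 2 ^ k)

theorem chainScale_sq (σ : ℝ) (k : ℕ) :
    chainScale σ k ^ 2 = 4 * σ ^ 2 * ((2 * k + 6) / 2 ^ k) := by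
  rw [chainScale, mul_pow, Real.sq_sqrt (by positivity)]
  ring

/-- Bernoulli's inequality gives 2k + 6 ≤ 16 (9/8)^k, so the terms are dominated by 8σ (3/4)^k, a
series with sum 32σ. -/
theorem sum_chainScale_le {σ : ℝ} (hσ : 0 ≤ σ) (n : ℕ) :
    ∑ k ∈ Finset.range n, chainScale σ k ≤ 32 * σ := by
  have h : ∀ k : ℕ, chainScale σ k ≤ 8 * σ * (3 / 4) ^ k := by
    intro k
    have h1 : √((2 * (k : ℝ) + 6) / 2 ^ k) ≤ 4 * (3 / 4) ^ k := by
      rw [Real.sqrt_le_left (by positivity), div_le_iff₀ (by positivity)]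
      have hb := one_add_mul_le_pow (a := (1 / 8 : ℝ)) (by norm_num) k
      have h2 : (4 * (3 / 4 : ℝ) ^ k) ^ 2 * 2 ^ k = 16 * (1 + 1 / 8) ^ k := by
        rw [mul_pow, ← pow_mul, mul_comm k 2, pow_mul, mul_assoc, ← mul_pow]
        norm_num
      rw [h2]
      linarith
    rw [chainScale]
    nlinarith
  calc ∑ k ∈ Finset.range n, chainScale σ k
      ≤ ∑ k ∈ Finset.range n, 8 * σ * (3 / 4) ^ k := Finset.sum_le_sum fun k _ => h k
    _ = 8 * σ * ∑ k ∈ Finset.range n, (3 / 4 : ℝ) ^ k := by rw [Finset.mul_sum]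
    _ ≤ 8 * σ * 4 := by
        gcongr
        refine (Summable.sum_le_tsum _ (fun j _ => by positivity)
          (summable_geometric_of_lt_one (by norm_num) (by norm_num))).trans ?_
        rw [tsum_geometric_of_lt_one (by norm_num) (by norm_num)]
        norm_num
    _ = 32 * σ := by ring

/-- This is the condition s ≤ 2v of the Bernstein bound with v = 2^{-k}. It reduces to (2k+6)σ ≤ 1,
which follows from 51σ ≤ 1 for k ≤ 4 and from 2k + 6 ≤ 2^k afterwards. -/
theorem chainScale_le {σ : ℝ} (hσ0 : 0 ≤ σ) (hσ : 51 * σ ≤ 1) {k K : ℕ} (hk : k ≤ K)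
    (hK : 2 ^ K * σ ≤ 1) : chainScale σ k ≤ 2 * (2 ^ k)⁻¹ := by
  have h1 : (2 * (k : ℝ) + 6) * σ ≤ 1 := by
    have hkK : (2 : ℝ) ^ k * σ ≤ 1 :=
      (mul_le_mul_of_nonneg_right (pow_le_pow_right₀ (by norm_num) hk) hσ0).trans hK
    rcases le_or_gt k 4 with h4 | h4
    · have : (k : ℝ) ≤ 4 := by exact_mod_cast h4
      nlinarith
    · have h5 : 2 * k + 6 ≤ 2 ^ k := by
        induction k, h4 using Nat.le_induction with
        | base => norm_num
        | succ n hn ih =>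
          have := ih (by omega) ((mul_le_mul_of_nonneg_right
            (pow_le_pow_right₀ (by norm_num) n.le_succ) hσ0).trans hkK)
          rw [pow_succ]
          omega
      have : (2 * (k : ℝ) + 6) ≤ 2 ^ k := by exact_mod_cast h5
      exact (mul_le_mul_of_nonneg_right this hσ0).trans hkK
  refine le_of_sq_le_sq ?_ (by positivity)
  have hkK : (2 : ℝ) ^ k * σ ≤ 1 :=
    (mul_le_mul_of_nonneg_right (pow_le_pow_right₀ (by norm_num) hk) hσ0).trans hK
  have hp : (0 : ℝ) < 2 ^ k := by positivity
  have h2 : chainScale σ k ^ 2 = 4 * (((2 * k + 6) * σ) * (2 ^ k * σ)) * ((2 ^ k)⁻¹) ^ 2 := by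
    rw [chainScale_sq]
    field_simp
  have h3 : ((2 * (k : ℝ) + 6) * σ) * (2 ^ k * σ) ≤ 1 :=
    mul_le_one₀ h1 (by positivity) hkK
  rw [h2, mul_pow]
  have : (0 : ℝ) ≤ ((2 ^ k)⁻¹) ^ 2 := by positivity
  nlinarith

/-- Union bound: at level k there are at most e^{d(k+3)} cells, each failing with probability at
most 2e^{-d(2k+6)}, so the level fails with probability at most 2e^{-d(k+3)} ≤ 2^{-k}/8. -/
theorem measure_exists_chain_ge_le {N d K : ℕ} (hd : 0 < d) (hN : 0 < N)
    (hσ : 51 * √((d : ℝ) / N) ≤ 1) (hK : 2 ^ K * √((d : ℝ) / N) ≤ 1) :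
    sampleMeasure N d (⋃ k ∈ Finset.range (K + 1), ⋃ c ∈ gridFinset d (gridBound d k),
      {x | N * chainScale √((d : ℝ) / N) k ≤ |dev x (box (gridPoint k c) \ prevBox k c)|})
      ≤ ENNReal.ofReal (1 / 4) := by
  set σ := √((d : ℝ) / N) with hσdef
  have hd' : (1 : ℝ) ≤ d := by exact_mod_cast hd
  have hN' : (0 : ℝ) < N := by exact_mod_cast hN
  have hσ2 : σ ^ 2 = d / N := Real.sq_sqrt (by positivity)
  have hσ0 : 0 ≤ σ := Real.sqrt_nonneg _
  have hcell : ∀ k ∈ Finset.range (K + 1), ∀ c : Fin d → ℕ,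
      sampleMeasure N d {x | N * chainScale σ k ≤ |dev x (box (gridPoint k c) \ prevBox k c)|}
        ≤ 2 * ENNReal.ofReal (Real.exp (-(d * (2 * k + 6)))) := by
    intro k hk c
    have hk' : k ≤ K := Nat.lt_succ_iff.1 (Finset.mem_range.1 hk)
    have := measure_abs_dev_ge_le (N := N) (s := chainScale σ k)
      ((measurableSet_box (gridPoint k c)).diff (measurableSet_prevBox k c))
      (by positivity : (0 : ℝ) < (2 ^ k)⁻¹) (measure_box_diff_prevBox_le hd k c)
      (by rw [chainScale]; positivity) (chainScale_le hσ0 hσ hk' hK)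
    rw [chainScale_sq, hσ2] at this
    convert this using 5
    field_simp
  have hlevel : ∀ k ∈ Finset.range (K + 1),
      sampleMeasure N d (⋃ c ∈ gridFinset d (gridBound d k),
        {x | N * chainScale σ k ≤ |dev x (box (gridPoint k c) \ prevBox k c)|})
        ≤ ENNReal.ofReal (1 / 8 * (1 / 2) ^ k) := by
    intro k hk
    refine (measure_biUnion_finset_le _ _).trans ((Finset.sum_le_sum fun c _ => hcell k hk c).trans ?_)
    rw [Finset.sum_const, nsmul_eq_mul, ← ENNReal.ofReal_natCast,
      show (2 : ℝ≥0∞) = ENNReal.ofReal 2 by simp, ← ENNReal.ofReal_mul (by norm_num),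
      ← ENNReal.ofReal_mul (by positivity)]
    refine ENNReal.ofReal_le_ofReal ?_
    have h1 := card_gridFinset_gridBound_le hd k
    have h2 : Real.exp (d * (k + 3)) * (2 * Real.exp (-(d * (2 * k + 6))))
        = 2 * Real.exp (-(d * (k + 3))) := by
      rw [mul_left_comm, ← Real.exp_add]
      ring_nf
    have h3 : Real.exp (-(d * (k + 3))) ≤ Real.exp (-(k : ℝ)) * Real.exp (-3) := by
      rw [← Real.exp_add, Real.exp_le_exp]
      have : (0 : ℝ) ≤ k := Nat.cast_nonneg k
      nlinarith
    have h4 : Real.exp (-3) ≤ 1 / 16 := by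
      rw [show (-3 : ℝ) = -((3 : ℕ) : ℝ) by norm_num, Real.exp_neg, one_div, ← Real.exp_one_pow]
      refine inv_anti₀ (by norm_num) ?_
      have : (2.7 : ℝ) ≤ Real.exp 1 := by linarith [Real.exp_one_gt_d9]
      exact le_trans (by norm_num) (pow_le_pow_left₀ (by norm_num) this 3)
    have h5 := exp_neg_le_two_inv_pow k
    calc _ ≤ Real.exp (d * (k + 3)) * (2 * Real.exp (-(d * (2 * k + 6)))) := by gcongr
      _ = 2 * Real.exp (-(d * (k + 3))) := h2
      _ ≤ 2 * ((2 ^ k)⁻¹ * (1 / 16)) := by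
        refine mul_le_mul_of_nonneg_left (h3.trans ?_) (by norm_num)
        exact mul_le_mul h5 h4 (Real.exp_pos _).le (by positivity)
      _ = _ := by rw [one_div_pow, one_div]; ring
  refine (measure_biUnion_finset_le _ _).trans ((Finset.sum_le_sum hlevel).trans ?_)
  rw [← ENNReal.ofReal_sum_of_nonneg fun k _ => by positivity]
  refine ENNReal.ofReal_le_ofReal ?_
  rw [← Finset.mul_sum]
  have : ∑ k ∈ Finset.range (K + 1), (1 / 2 : ℝ) ^ k ≤ 2 := by
    refine (Summable.sum_le_tsum _ (fun j _ => by positivity) summable_geometric_two).trans ?_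
    rw [tsum_geometric_two]
  linarith

theorem abs_dev_le {N d : ℕ} (x : Fin N → Fin d → ℝ) (A : Set (Fin d → ℝ)) : |dev x A| ≤ N := by
  have ha : 0 ≤ (cubeMeasure d).real A := measureReal_nonneg
  have ha1 : (cubeMeasure d).real A ≤ 1 := measureReal_le_one
  refine (Finset.abs_sum_le_sum_abs _ _).trans ?_
  refine (Finset.sum_le_card_nsmul _ _ 1 fun j _ => ?_).trans (by simp)
  rw [abs_le]
  by_cases h : x j ∈ A <;> simp only [h, Set.indicator_of_mem, Set.indicator_of_notMem,
    not_false_eq_true, Pi.one_apply] <;> constructor <;> linarith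

theorem measure_exists_dev_box_gt_le {N d : ℕ} (hd : 0 < d) (hN0 : 0 < N) :
    sampleMeasure N d {x | ¬ ∀ t : Fin d → ℝ, (∀ i, 0 ≤ t i) → (∀ i, t i ≤ 1) →
      |dev x (box t)| ≤ N * (51 * √((d : ℝ) / N))} ≤ ENNReal.ofReal (1 / 4) := by
  have hd' : (0 : ℝ) < d := by exact_mod_cast hd
  have hN' : (0 : ℝ) < N := by exact_mod_cast hN0
  set σ := √((d : ℝ) / N) with hσdef
  have hσpos : 0 < σ := Real.sqrt_pos.2 (by positivity)
  rcases lt_or_ge 1 (51 * σ) with hσ | hσ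
  -- If 51σ > 1, the trivial bound |dev| ≤ N already suffices.
  · refine (measure_mono_null (fun x hx => ?_) measure_empty).trans_le zero_le
    refine hx fun t _ _ => (abs_dev_le x _).trans ?_
    nlinarith
  -- The chain stops where 2^{-K} is comparable to σ: the final rounding then costs 2 · 2^{-K} ≤ 4σ,
  -- and 32σ + 4σ ≤ 51σ.
  obtain ⟨K, hK1, hK2⟩ := exists_nat_pow_near (x := 1 / σ) (y := 2)
    (by rw [le_div_iff₀ hσpos]; linarith) (by norm_num)
  rw [le_div_iff₀ hσpos] at hK1
  rw [div_lt_iff₀ hσpos] at hK2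
  -- The bad event involves uncountably many t; being covered by the finite union of chain events,
  -- it needs no measurability.
  refine (measure_mono ?_).trans (measure_exists_chain_ge_le hd hN0 hσ hK1)
  intro x hx
  by_contra hgood
  refine hx fun t h0 h1 => ?_
  have hchain : ∀ k ≤ K, ∀ c : Fin d → ℕ, ∑ i, c i ≤ gridBound d k →
      |dev x (box (gridPoint k c) \ prevBox k c)| ≤ N * chainScale σ k := by
    intro k hk c hc
    by_contra hlt
    refine hgood (Set.mem_biUnion (Finset.mem_coe.2 (Finset.mem_range.2 (Nat.lt_succ_of_le hk)))
      (Set.mem_biUnion (Finset.mem_coe.2 (mem_gridFinset.2 hc)) ?_))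
    exact (not_le.1 hlt).le
  have h2 := abs_dev_box_le hd x (abs_dev_gridPoint_le x _ hchain K le_rfl) h0 h1
  have h3 := sum_chainScale_le hσpos.le (K + 1)
  rw [← Finset.mul_sum] at h2
  have h4 : ((2 : ℝ) ^ K)⁻¹ ≤ 2 * σ := by
    rw [inv_le_iff_one_le_mul₀ (by positivity)]
    rw [pow_succ] at hK2
    linarith
  refine h2.trans ?_
  rw [← mul_add]
  exact mul_le_mul_of_nonneg_left (by linarith) hN'.le

/-! ### The square-exponential moment -/

theorem lintegral_exp_neg_mul_sq {b : ℝ} (hb : 0 < b) :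
    ∫⁻ g : ℝ, ENNReal.ofReal (Real.exp (-b * g ^ 2)) = ENNReal.ofReal √(Real.pi / b) := by
  rw [← ofReal_integral_eq_lintegral_ofReal (integrable_exp_neg_mul_sq hb)
    (Filter.Eventually.of_forall fun g => (Real.exp_pos _).le), integral_gaussian]

/-- The Gaussian linearisation of `exp (y ^ 2)`. -/
theorem lintegral_exp_neg_sq_add (y : ℝ) :
    ∫⁻ g : ℝ, ENNReal.ofReal (Real.exp (-g ^ 2) * Real.exp (2 * g * y))
      = ENNReal.ofReal √Real.pi * ENNReal.ofReal (Real.exp (y ^ 2)) := by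
  have h : ∀ g : ℝ, ENNReal.ofReal (Real.exp (-g ^ 2) * Real.exp (2 * g * y))
      = ENNReal.ofReal (Real.exp (y ^ 2)) * ENNReal.ofReal (Real.exp (-1 * (g - y) ^ 2)) := by
    intro g
    rw [← ENNReal.ofReal_mul (Real.exp_pos _).le, ← Real.exp_add, ← Real.exp_add]
    ring_nf
  simp only [h]
  rw [lintegral_const_mul' _ _ ENNReal.ofReal_ne_top,
    lintegral_sub_right_eq_self (fun g : ℝ => ENNReal.ofReal (Real.exp (-1 * g ^ 2))) y,
    lintegral_exp_neg_mul_sq one_pos, div_one, mul_comm]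

/-- After linearisation with y = dev/√(11N), the sub-Gaussian bound contributes e^{4g²/11}. Against
e^{-g²} this leaves a Gaussian integral with parameter 7/11, and √(11/7) ≤ 63/50. -/
theorem lintegral_exp_dev_sq_le {N d : ℕ} (hN : 0 < N) {A : Set (Fin d → ℝ)}
    (hA : MeasurableSet A) :
    ∫⁻ x, ENNReal.ofReal (Real.exp (dev x A ^ 2 / (11 * N))) ∂sampleMeasure N d
      ≤ ENNReal.ofReal (63 / 50) := by
  have hN' : (0 : ℝ) < N := by exact_mod_cast hN
  set r : ℝ := √(11 * N) with hr
  have hr2 : r ^ 2 = 11 * N := Real.sq_sqrt (by positivity)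
  have hr0 : 0 < r := Real.sqrt_pos.2 (by positivity)
  have hpi : (0 : ℝ) < √Real.pi := Real.sqrt_pos.2 Real.pi_pos
  have hm : Measurable fun x : Fin N → Fin d → ℝ => dev x A := measurable_dev hA
  have key : ENNReal.ofReal √Real.pi
      * ∫⁻ x, ENNReal.ofReal (Real.exp (dev x A ^ 2 / (11 * N))) ∂sampleMeasure N d
      ≤ ENNReal.ofReal √(Real.pi / (7 / 11)) := by
    calc _ = ∫⁻ x, (∫⁻ g : ℝ, ENNReal.ofReal (Real.exp (-g ^ 2) *
            Real.exp (2 * g * (dev x A / r)))) ∂sampleMeasure N d := by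
          rw [← lintegral_const_mul' _ _ ENNReal.ofReal_ne_top]
          refine lintegral_congr fun x => ?_
          rw [lintegral_exp_neg_sq_add, div_pow, hr2]
      _ = ∫⁻ g : ℝ, ∫⁻ x, ENNReal.ofReal (Real.exp (-g ^ 2) * Real.exp (2 * g * (dev x A / r)))
            ∂sampleMeasure N d := by
          refine lintegral_lintegral_swap (Measurable.aemeasurable ?_)
          refine Measurable.ennreal_ofReal ?_
          have h1 : Measurable fun p : (Fin N → Fin d → ℝ) × ℝ => dev p.1 A := hm.comp measurable_fst
          fun_prop
      _ ≤ ∫⁻ g : ℝ, ENNReal.ofReal (Real.exp (-(7 / 11) * g ^ 2)) := by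
          refine lintegral_mono fun g => ?_
          simp only [ENNReal.ofReal_mul (Real.exp_pos _).le]
          rw [lintegral_const_mul' _ _ ENNReal.ofReal_ne_top]
          have h1 := lintegral_exp_mul_dev_le (N := N) hA
            (integral_exp_mul_indicator_sub_le_exp_sq hA (2 * g / r))
          have h2 : ∀ x : Fin N → Fin d → ℝ, 2 * g * (dev x A / r) = 2 * g / r * dev x A := by
            intro x; ring
          simp only [h2]
          refine (mul_le_mul_right h1 _).trans (le_of_eq ?_)
          rw [← ENNReal.ofReal_mul (Real.exp_pos _).le, ← Real.exp_add, div_pow, hr2]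
          congr 2
          field_simp
          ring
      _ = _ := lintegral_exp_neg_mul_sq (by norm_num)
  have h1 : √(Real.pi / (7 / 11)) ≤ √Real.pi * (63 / 50) := by
    rw [Real.sqrt_le_left (by positivity), mul_pow, Real.sq_sqrt Real.pi_pos.le]
    nlinarith [Real.pi_pos]
  have h2 := key.trans (ENNReal.ofReal_le_ofReal h1)
  rw [ENNReal.ofReal_mul hpi.le] at h2
  exact (ENNReal.mul_le_mul_iff_right (by simpa using hpi) ENNReal.ofReal_ne_top).1 h2

theorem measurable_dev_box (N d : ℕ) :
    Measurable fun p : (Fin N → Fin d → ℝ) × (Fin d → ℝ) => dev p.1 (box p.2) := by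
  have hbox : MeasurableSet {q : (Fin d → ℝ) × (Fin d → ℝ) | q.2 ∈ box q.1} := by
    simp only [box, Set.mem_univ_pi, Set.mem_Ico]
    measurability
  have h1 : Measurable fun t : Fin d → ℝ => (cubeMeasure d).real (box t) :=
    (measurable_measure_prodMk_left (ν := cubeMeasure d) hbox).ennreal_toReal
  unfold dev
  refine Finset.measurable_sum _ fun j _ => Measurable.sub ?_ (h1.comp measurable_snd)
  have h2 : (fun p : (Fin N → Fin d → ℝ) × (Fin d → ℝ) =>
      (box p.2).indicator (1 : (Fin d → ℝ) → ℝ) (p.1 j))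
      = {p | (p.2, p.1 j) ∈ {q : (Fin d → ℝ) × (Fin d → ℝ) | q.2 ∈ box q.1}}.indicator 1 := by
    ext p
    by_cases h : p.1 j ∈ box p.2 <;> simp [h]
  rw [h2]
  refine measurable_one.indicator (hbox.preimage (f := fun p : (Fin N → Fin d → ℝ) ×
    (Fin d → ℝ) => (p.2, p.1 j)) ?_)
  fun_prop

/-- Tonelli carries the mean bound 63/50 for a single box over to the integral over t; Markov's
inequality at level 9/5 then leaves the quotient 7/10. -/
theorem measure_lintegral_exp_dev_sq_ge_le {N d : ℕ} (hN : 0 < N) :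
    sampleMeasure N d {x | ENNReal.ofReal (9 / 5)
      ≤ ∫⁻ t, ENNReal.ofReal (Real.exp (dev x (box t) ^ 2 / (11 * N))) ∂cubeMeasure d}
      ≤ ENNReal.ofReal (7 / 10) := by
  have hm : Measurable fun p : (Fin N → Fin d → ℝ) × (Fin d → ℝ) =>
      ENNReal.ofReal (Real.exp (dev p.1 (box p.2) ^ 2 / (11 * N))) := by
    have := measurable_dev_box N d
    fun_prop
  have h1 : ∫⁻ x, ∫⁻ t, ENNReal.ofReal (Real.exp (dev x (box t) ^ 2 / (11 * N)))
      ∂cubeMeasure d ∂sampleMeasure N d ≤ ENNReal.ofReal (63 / 50) := by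
    rw [lintegral_lintegral_swap hm.aemeasurable]
    refine (lintegral_mono fun t => lintegral_exp_dev_sq_le hN (measurableSet_box t)).trans ?_
    simp
  have h2 := mul_meas_ge_le_lintegral₀ (μ := sampleMeasure N d)
    (hm.lintegral_prod_right' (ν := cubeMeasure d)).aemeasurable (ENNReal.ofReal (9 / 5))
  have h3 := h2.trans h1
  rw [show (63 / 50 : ℝ) = 9 / 5 * (7 / 10) by norm_num,
    ENNReal.ofReal_mul (by norm_num)] at h3
  exact (ENNReal.mul_le_mul_iff_right (by simp) ENNReal.ofReal_ne_top).1 h3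

/-- Point sets that are good for the uniform and for the square-exponential deviation. -/
theorem exists_points {N d : ℕ} (hd : 0 < d) (hN0 : 0 < N) :
    ∃ x : Fin N → Fin d → ℝ, Function.Injective x ∧ (∀ j, x j ∈ Set.Icc 0 1) ∧
      (∀ t ∈ Set.Icc (0 : Fin d → ℝ) 1, |localDiscrepancy x t| ≤ 51 * √((d : ℝ) / N)) ∧
      ∫⁻ t in Set.Icc (0 : Fin d → ℝ) 1,
        ENNReal.ofReal (Real.exp (N * localDiscrepancy x t ^ 2 / 11)) ≤ ENNReal.ofReal (9 / 5) := by
  have hN' : (0 : ℝ) < N := by exact_mod_cast hN0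
  have hb1 := measure_exists_dev_box_gt_le hd hN0
  have hb2 := measure_lintegral_exp_dev_sq_ge_le (d := d) hN0
  set B₁ := {x : Fin N → Fin d → ℝ | ¬ ∀ t : Fin d → ℝ, (∀ i, 0 ≤ t i) → (∀ i, t i ≤ 1) →
      |dev x (box t)| ≤ N * (51 * √((d : ℝ) / N))}
  set B₂ := {x : Fin N → Fin d → ℝ | ENNReal.ofReal (9 / 5)
      ≤ ∫⁻ t, ENNReal.ofReal (Real.exp (dev x (box t) ^ 2 / (11 * N))) ∂cubeMeasure d}
  have hex : ∃ x, Function.Injective x ∧ (∀ j, x j ∈ Set.Icc 0 1) ∧ x ∉ B₁ ∧ x ∉ B₂ := by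
    by_contra hno
    push Not at hno
    have hae : ∀ᵐ x ∂sampleMeasure N d, x ∈ B₁ ∪ B₂ := by
      filter_upwards [ae_sampleMeasure_injective N hd, ae_sampleMeasure_mem_Icc N d] with x h1 h2
      by_cases h3 : x ∈ B₁
      · exact Or.inl h3
      · exact Or.inr (hno x h1 h2 h3)
    have h1 : 1 ≤ sampleMeasure N d (B₁ ∪ B₂) := by
      rw [← measure_univ (μ := sampleMeasure N d)]
      exact measure_mono_ae (hae.mono fun x hx _ => hx)
    -- The contradiction is 1 ≤ 1/4 + 7/10.
    have h2 := h1.trans ((measure_union_le _ _).trans (add_le_add hb1 hb2))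
    rw [← ENNReal.ofReal_add (by norm_num) (by norm_num), ENNReal.one_le_ofReal] at h2
    norm_num at h2
  obtain ⟨x, hinj, hmem, h1, h2⟩ := hex
  refine ⟨x, hinj, hmem, fun t ht => ?_, ?_⟩
  · rw [localDiscrepancy_eq hN0 x ht.1 ht.2, abs_div, abs_of_pos hN', div_le_iff₀ hN', mul_comm]
    exact not_not.1 h1 t ht.1 ht.2
  · refine le_trans (le_of_eq ?_) (not_le.1 h2).le
    refine setLIntegral_congr_fun measurableSet_Icc fun t ht => ?_
    rw [localDiscrepancy_eq hN0 x ht.1 ht.2]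
    congr 2
    field_simp

/-! ### The norm of the initial discrepancy -/

theorem exp_neg_one_le_one_sub_pow_rpow {α : ℝ} (hα : 0 < α) {d : ℕ} (hd : 0 < d) :
    Real.exp (-1) ≤ ((1 - 1 / (α * d + 1)) ^ d) ^ α := by
  have hd' : (0 : ℝ) < d := by exact_mod_cast hd
  have hm : 0 < α * d := by positivity
  have h1 : 1 - 1 / (α * d + 1) = (1 + 1 / (α * d))⁻¹ := by
    field_simp
    ring
  have h2 : Real.exp (-(1 / (α * d))) ≤ 1 - 1 / (α * d + 1) := by
    rw [h1, Real.exp_neg]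
    exact inv_anti₀ (by positivity) (by linarith [Real.add_one_le_exp (1 / (α * d))])
  calc Real.exp (-1) = (Real.exp (-(1 / (α * d))) ^ d) ^ α := by
        rw [← Real.exp_nat_mul, ← Real.exp_mul]
        congr 1
        field_simp
    _ ≤ _ := by gcongr

/-- Bernoulli gives 1 + αd ≤ (1 + d)^α. The additional 1 costs a factor 3/2 since y ≥ 2, and (3/2)^5
≤ 2^3 turns this into the factor 1 + 3/5 on the logarithm. -/
theorem log_one_add_pow_le {α : ℝ} (hα : 1 ≤ α) {d : ℕ} (hd : 0 < d) :
    Real.log (1 + (α * d + 1) ^ d) ≤ 8 / 5 * (α * d * Real.log (d + 1)) := by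
  have hd' : (1 : ℝ) ≤ d := by exact_mod_cast hd
  set y : ℝ := ((d : ℝ) + 1) ^ (α * d) with hy
  have hlogy : Real.log y = α * d * Real.log (d + 1) := Real.log_rpow (by positivity) _
  have hy2 : 2 ≤ y := by
    have h1 : (1 : ℝ) ≤ α * d := by nlinarith
    calc (2 : ℝ) ≤ ((d : ℝ) + 1) ^ (1 : ℝ) := by rw [Real.rpow_one]; linarith
      _ ≤ y := Real.rpow_le_rpow_of_exponent_le (by linarith) h1
  have h1 : (α * d + 1) ^ d ≤ y := by
    have h2 := one_add_mul_self_le_rpow_one_add (s := (d : ℝ)) (by linarith) hα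
    calc (α * d + 1) ^ d ≤ (((d : ℝ) + 1) ^ α) ^ d := by
          refine pow_le_pow_left₀ (by positivity) ?_ d
          rw [add_comm, add_comm (d : ℝ)]; exact h2
      _ = y := by rw [hy, Real.rpow_mul (by positivity), Real.rpow_natCast]
  have h3 : Real.log (3 / 2) ≤ 3 / 5 * Real.log 2 := by
    have h4 : Real.log ((3 / 2) ^ 5) ≤ Real.log (2 ^ 3) :=
      Real.log_le_log (by norm_num) (by norm_num)
    rw [Real.log_pow, Real.log_pow] at h4
    push_cast at h4
    linarith
  have h5 : Real.log (1 + (α * d + 1) ^ d) ≤ Real.log (3 / 2 * y) :=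
    Real.log_le_log (by positivity) (by linarith)
  rw [Real.log_mul (by norm_num) (by linarith)] at h5
  have h6 : Real.log 2 ≤ Real.log y := Real.log_le_log (by norm_num) hy2
  rw [hlogy] at h5 h6
  linarith

/-- On the corner cube of side η = 1/(αd+1) at (1,…,1), the α-th power of the volume of [0,x] is at
least 1/e. This cube alone forces exp(e^{-1}/K^α) - 1 ≤ (αd+1)^d. The constant is 22/5 =
(8/5)(11/4), with e ≤ 11/4. -/
theorem rpow_ge_of_lintegral_psi_le {α : ℝ} (hα : 1 ≤ α) {d : ℕ} (hd : 0 < d) {K : ℝ} (hK : 0 < K)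
    (h : ∫⁻ x in Set.Icc (0 : Fin d → ℝ) 1,
      ENNReal.ofReal (psi α (|emptyLocalDiscrepancy d x| / K)) ≤ 1) :
    (22 / 5 * (α * d * Real.log (d + 1)))⁻¹ ≤ K ^ α := by
  have hd' : (1 : ℝ) ≤ d := by exact_mod_cast hd
  have hα0 : 0 < α := by linarith
  have hm : 0 < α * d + 1 := by positivity
  set η : ℝ := 1 / (α * d + 1) with hη
  have hη0 : 0 < η := by positivity
  have hη1 : η ≤ 1 := by rw [hη, div_le_one hm]; nlinarith
  have hsub : Set.Icc (fun _ : Fin d => 1 - η) 1 ⊆ Set.Icc 0 1 :=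
    Set.Icc_subset_Icc_left fun _ => by simpa using hη1
  have hKα : 0 < K ^ α := Real.rpow_pos_of_pos hK α
  set E : ℝ := Real.exp (-1) / K ^ α with hE
  have hpt : ∀ x ∈ Set.Icc (fun _ : Fin d => 1 - η) 1,
      ENNReal.ofReal (Real.exp E - 1)
        ≤ ENNReal.ofReal (psi α (|emptyLocalDiscrepancy d x| / K)) := by
    intro x hx
    have hx0 : ∀ i, 0 ≤ x i := (hsub hx).1
    have hprod : (1 - η) ^ d ≤ ∏ i, x i := by
      calc (1 - η) ^ d = ∏ _i : Fin d, (1 - η) := by simp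
        _ ≤ _ := Finset.prod_le_prod (fun _ _ => by linarith) fun i _ => hx.1 i
    have hη' : (0 : ℝ) ≤ (1 - η) ^ d := pow_nonneg (by linarith) d
    refine ENNReal.ofReal_le_ofReal (sub_le_sub_right (Real.exp_le_exp.2 ?_) 1)
    rw [emptyLocalDiscrepancy, volume_Icc_zero_toReal hx0, abs_neg,
      abs_of_nonneg (hη'.trans hprod), Real.div_rpow (hη'.trans hprod) hK.le]
    refine div_le_div_of_nonneg_right ?_ hKα.le
    exact (exp_neg_one_le_one_sub_pow_rpow hα0 hd).trans
      (Real.rpow_le_rpow hη' hprod hα0.le)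
  have hvol : volume (Set.Icc (fun _ : Fin d => 1 - η) 1) = ENNReal.ofReal (η ^ d) := by
    rw [← Set.pi_univ_Icc, volume_pi_pi]
    simp [ENNReal.ofReal_pow hη0.le]
  have hE0 : 0 < E := by positivity
  have hE1 : 0 ≤ Real.exp E - 1 := by linarith [Real.add_one_le_exp E]
  have h1 : (Real.exp E - 1) * η ^ d ≤ 1 := by
    rw [← ENNReal.ofReal_le_one, ENNReal.ofReal_mul hE1, ← hvol, ← setLIntegral_const]
    exact (setLIntegral_mono' measurableSet_Icc hpt).trans ((lintegral_mono_set hsub).trans h)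
  have h2 : Real.exp E ≤ 1 + (α * d + 1) ^ d := by
    rw [hη, one_div, inv_pow, ← div_eq_mul_inv, div_le_one (by positivity)] at h1
    linarith
  have h3 : E ≤ 8 / 5 * (α * d * Real.log (d + 1)) :=
    ((Real.le_log_iff_exp_le (by positivity)).2 h2).trans (log_one_add_pow_le hα hd)
  have hL : 0 < α * d * Real.log (d + 1) := by
    have := Real.log_pos (by linarith : (1 : ℝ) < d + 1)
    positivity
  rw [inv_le_iff_one_le_mul₀ (by positivity)]
  rw [hE, div_le_iff₀ hKα, Real.exp_neg] at h3
  have h4 : Real.exp 1 ≤ 11 / 4 := by linarith [Real.exp_one_lt_d9]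
  have h5 : (4 / 11 : ℝ) ≤ (Real.exp 1)⁻¹ := by
    rw [show (4 / 11 : ℝ) = (11 / 4)⁻¹ by norm_num]
    exact inv_anti₀ (Real.exp_pos _) h4
  nlinarith [mul_pos hL hKα]

theorem ofReal_le_psiNorm_emptyLocalDiscrepancy {α : ℝ} (hα : 1 ≤ α) {d : ℕ} (hd : 0 < d) :
    ENNReal.ofReal ((22 / 5 * (α * d * Real.log (d + 1)))⁻¹ ^ (1 / α))
      ≤ psiNorm α d (emptyLocalDiscrepancy d) := by
  have hα0 : 0 < α := by linarith
  have hd' : (1 : ℝ) ≤ d := by exact_mod_cast hd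
  refine le_iInf fun K => le_iInf fun hK => le_iInf fun h => ENNReal.ofReal_le_ofReal ?_
  have hlog : 0 ≤ Real.log ((d : ℝ) + 1) := Real.log_nonneg (by linarith)
  calc _ ≤ (K ^ α) ^ (1 / α) :=
        Real.rpow_le_rpow (by positivity) (rpow_ge_of_lintegral_psi_le hα hd hK h) (by positivity)
    _ = K := by rw [one_div, Real.rpow_rpow_inv hK.le hα0.ne']

/-! ### The norm of the discrepancy of good points -/

/-- The summand 1/11 in the exponent costs a factor e^{1/11} ≤ 11/10, and (11/10)(9/5) - 1 ≤ 1. -/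
theorem psiNorm_localDiscrepancy_le {α κ : ℝ} (hκ : 0 < κ) {N d : ℕ} {x : Fin N → Fin d → ℝ}
    (hint : ∫⁻ t in Set.Icc (0 : Fin d → ℝ) 1,
      ENNReal.ofReal (Real.exp (N * localDiscrepancy x t ^ 2 / 11)) ≤ ENNReal.ofReal (9 / 5))
    (hpt : ∀ t ∈ Set.Icc (0 : Fin d → ℝ) 1,
      (|localDiscrepancy x t| / κ) ^ α ≤ (1 + N * localDiscrepancy x t ^ 2) / 11) :
    psiNorm α d (localDiscrepancy x) ≤ ENNReal.ofReal κ := by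
  refine iInf_le_of_le κ (iInf_le_of_le hκ (iInf_le_of_le ?_ le_rfl))
  have he : Real.exp (1 / 11) ≤ 11 / 10 := by
    have h1 := Real.add_one_le_exp (-(1 / 11) : ℝ)
    have h2 : Real.exp (1 / 11) * Real.exp (-(1 / 11)) = 1 := by
      rw [← Real.exp_add]; simp
    nlinarith [Real.exp_pos (1 / 11 : ℝ)]
  have hexp : ∀ t ∈ Set.Icc (0 : Fin d → ℝ) 1,
      ENNReal.ofReal (psi α (|localDiscrepancy x t| / κ))
        ≤ ENNReal.ofReal (11 / 10)
          * ENNReal.ofReal (Real.exp (N * localDiscrepancy x t ^ 2 / 11)) - 1 := by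
    intro t ht
    rw [← ENNReal.ofReal_mul (by norm_num), ← ENNReal.ofReal_one,
      ← ENNReal.ofReal_sub _ zero_le_one]
    refine ENNReal.ofReal_le_ofReal (sub_le_sub_right ?_ 1)
    refine (Real.exp_le_exp.2 (hpt t ht)).trans ?_
    rw [add_div, Real.exp_add]
    exact mul_le_mul_of_nonneg_right he (Real.exp_pos _).le
  have hvol : ∫⁻ _t in Set.Icc (0 : Fin d → ℝ) 1, (1 : ℝ≥0∞) = 1 := by
    rw [setLIntegral_one]
    exact (Measure.restrict_apply_univ _).symm.trans (measure_univ (μ := cubeMeasure d))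
  refine (setLIntegral_mono' measurableSet_Icc hexp).trans ?_
  -- Only the subtracted constant has to be measurable. The truncated subtraction is a genuine one
  -- because the minuend is at least 1, as checked in the last bullet.
  rw [lintegral_sub measurable_const (by rw [hvol]; exact ENNReal.one_ne_top), hvol,
    lintegral_const_mul' _ _ ENNReal.ofReal_ne_top]
  · refine (tsub_le_tsub_right (mul_le_mul_right hint _) 1).trans ?_
    rw [← ENNReal.ofReal_mul (by norm_num), ← ENNReal.ofReal_one,
      ← ENNReal.ofReal_sub _ zero_le_one]
    exact ENNReal.ofReal_le_ofReal (by norm_num)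
  · refine Filter.Eventually.of_forall fun t => ?_
    simp only
    rw [← ENNReal.ofReal_mul (by norm_num), ENNReal.one_le_ofReal]
    have : 1 ≤ Real.exp (N * localDiscrepancy x t ^ 2 / 11) := Real.one_le_exp (by positivity)
    linarith

/-- Applied with u = √N |Δ| and m = √N κ: the quadratic exponent alone dominates, and the uniform
bound is not needed. -/
theorem rpow_div_le_of_le_two {α u m : ℝ} (hα : 1 ≤ α) (hα2 : α ≤ 2) (hu : 0 ≤ u) (hm : 11 ≤ m) :
    (u / m) ^ α ≤ (1 + u ^ 2) / 11 := by
  rw [Real.div_rpow hu (by linarith)]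
  have h1 : u ^ α ≤ 1 + u ^ 2 := by
    rcases le_total u 1 with h | h
    · have := Real.rpow_le_one hu h (by linarith : 0 ≤ α)
      nlinarith [sq_nonneg u]
    · have := Real.rpow_le_rpow_of_exponent_le h hα2
      rw [Real.rpow_two] at this
      linarith
  have h2 : 11 ≤ m ^ α := by
    refine hm.trans ?_
    have := Real.rpow_le_rpow_of_exponent_le (by linarith : 1 ≤ m) hα
    rwa [Real.rpow_one] at this
  exact div_le_div₀ (by positivity) h1 (by norm_num) h2

/-- Interpolation between the two bounds: in D^α = D² D^{α-2} the second factor is controlled by the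
uniform bound √w. -/
theorem rpow_div_le_of_two_le {α D κ w N : ℝ} (hα : 2 ≤ α) (hD : 0 ≤ D) (hκ : 0 < κ) (hw : 0 < w)
    (hDw : D ≤ √w) (hwκ : 11 * w ^ (α / 2) ≤ N * w * κ ^ α) :
    (D / κ) ^ α ≤ N * D ^ 2 / 11 := by
  have hκα : 0 < κ ^ α := Real.rpow_pos_of_pos hκ α
  rw [Real.div_rpow hD hκ.le, div_le_div_iff₀ hκα (by norm_num)]
  rcases hD.eq_or_lt with rfl | hD0
  · rw [Real.zero_rpow (by linarith)]; simp
  have h1 : D ^ α = D ^ 2 * D ^ (α - 2) := by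
    rw [← Real.rpow_two, ← Real.rpow_add hD0]; ring_nf
  have h2 : D ^ (α - 2) ≤ w ^ (α / 2) / w := by
    calc D ^ (α - 2) ≤ √w ^ (α - 2) := Real.rpow_le_rpow hD hDw (by linarith)
      _ = w ^ (α / 2 - 1) := by
        rw [Real.sqrt_eq_rpow, ← Real.rpow_mul hw.le]; ring_nf
      _ = w ^ (α / 2) / w := by rw [Real.rpow_sub hw, Real.rpow_one]
  have h3 : 11 * (w ^ (α / 2) / w) ≤ N * κ ^ α := by
    rw [← mul_div_assoc, div_le_iff₀ hw]; linarith
  rw [h1]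
  nlinarith [mul_le_mul_of_nonneg_left (mul_le_mul_of_nonneg_left h2 (by norm_num : (0 : ℝ) ≤ 11))
    (sq_nonneg D), mul_le_mul_of_nonneg_left h3 (sq_nonneg D)]

/-! ### Comparison of the minimal and the initial discrepancy -/

theorem minimalDiscrepancy_psiNorm_le {α : ℝ} (hα : 1 ≤ α) {ε : ℝ} (hε : 0 < ε) {d : ℕ}
    (hd : 0 < d) {N : ℕ}
    (hN : 2601 * α ^ (2 / α) * (d : ℝ) ^ max 1 (2 / α) * Real.log ((d : ℝ) + 1) ^ (2 / α)
      ≤ N * ε ^ 2) :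
    minimalDiscrepancy (psiNorm α) N d
      ≤ ENNReal.ofReal ε * psiNorm α d (emptyLocalDiscrepancy d) := by
  have hα0 : 0 < α := by linarith
  have hd' : (1 : ℝ) ≤ d := by exact_mod_cast hd
  have hlog : 0 < Real.log ((d : ℝ) + 1) := Real.log_pos (by linarith)
  have hNpos : 0 < (N : ℝ) := by
    have : 0 < N * ε ^ 2 := lt_of_lt_of_le (by positivity) hN
    exact pos_of_mul_pos_left this (by positivity)
  have hN0 : 0 < N := by exact_mod_cast hNpos
  obtain ⟨x, hinj, hmem, hsup, hint⟩ := exists_points (N := N) hd hN0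
  set a : ℝ := (22 / 5 * (α * d * Real.log (d + 1)))⁻¹ with ha
  have ha0 : 0 < a := by positivity
  set κ : ℝ := ε * a ^ (1 / α) with hκ
  have hκ0 : 0 < κ := by positivity
  have hκα : κ ^ α = ε ^ α * a := by
    rw [hκ, Real.mul_rpow hε.le (by positivity), ← Real.rpow_mul ha0.le, one_div_mul_cancel hα0.ne',
      Real.rpow_one]
  have hbound : psiNorm α d (localDiscrepancy x) ≤ ENNReal.ofReal κ := by
    refine psiNorm_localDiscrepancy_le hκ0 hint fun t ht => ?_
    set D := localDiscrepancy x t with hDdef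
    rcases le_total α 2 with h2 | h2
    · have hmax : max 1 (2 / α) = 2 / α := max_eq_right (by rw [le_div_iff₀ hα0]; linarith)
      have hm : 121 ≤ N * κ ^ 2 := by
        set L := α * d * Real.log (d + 1) with hL
        have hL0 : 0 < L := by positivity
        have hLN : 2601 * L ^ (2 / α) ≤ N * ε ^ 2 := by
          rw [hmax] at hN
          rwa [hL, Real.mul_rpow (by positivity) hlog.le, Real.mul_rpow hα0.le (by positivity),
            ← mul_assoc, ← mul_assoc]
        -- As α ≥ 1, it suffices that 2601 ≥ 121 (22/5)².
        have h4 : (22 / 5 : ℝ) ^ (2 / α) ≤ (22 / 5) ^ (2 : ℝ) :=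
          Real.rpow_le_rpow_of_exponent_le (by norm_num)
            (by rw [div_le_iff₀ hα0]; linarith)
        rw [Real.rpow_two] at h4
        have h5 : κ ^ 2 = ε ^ 2 * ((22 / 5) ^ (2 / α) * L ^ (2 / α))⁻¹ := by
          rw [hκ, mul_pow, ← Real.rpow_two (a ^ (1 / α)), ← Real.rpow_mul ha0.le, ha,
            Real.inv_rpow (by positivity), one_div_mul_eq_div, Real.mul_rpow (by norm_num) hL0.le]
        have hp : 0 < L ^ (2 / α) := by positivity
        have hq : (0 : ℝ) < (22 / 5) ^ (2 / α) := by positivity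
        rw [h5, ← mul_assoc, ← div_eq_mul_inv, le_div_iff₀ (by positivity)]
        nlinarith
      have hsq : √(N : ℝ) ^ 2 = N := Real.sq_sqrt hNpos.le
      have hs : 0 < √(N : ℝ) := Real.sqrt_pos.2 hNpos
      have hm' : 11 ≤ √(N : ℝ) * κ := by
        refine le_of_sq_le_sq ?_ (by positivity)
        rw [mul_pow, hsq]
        linarith
      have := rpow_div_le_of_le_two hα h2 (u := √(N : ℝ) * |D|) (by positivity) hm'
      rwa [mul_div_mul_left _ _ hs.ne', mul_pow, hsq, sq_abs] at this
    · have hmax : max 1 (2 / α) = 1 := max_eq_left (by rw [div_le_iff₀ hα0]; linarith)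
      -- The square of the uniform bound 51 √(d/N). In N w κ^α the factor d of w cancels the factor
      -- 1/d of κ^α.
      set w : ℝ := 2601 * d / N with hw
      have hw0 : 0 < w := by positivity
      have hDw : |D| ≤ √w := by
        have h3 : √w = 51 * √((d : ℝ) / N) := by
          rw [hw, mul_div_assoc, Real.sqrt_mul (by norm_num),
            show (2601 : ℝ) = 51 ^ 2 by norm_num, Real.sqrt_sq (by norm_num)]
        rw [h3]
        exact hsup t ht
      have hP : 0 < α * Real.log (d + 1) := by positivity
      have hwle : w ≤ ε ^ 2 / (α * Real.log (d + 1)) ^ (2 / α) := by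
        rw [hmax, Real.rpow_one] at hN
        rw [hw, div_le_div_iff₀ hNpos (by positivity), Real.mul_rpow hα0.le hlog.le]
        linarith
      have hwα : w ^ (α / 2) ≤ ε ^ α / (α * Real.log (d + 1)) := by
        refine (Real.rpow_le_rpow hw0.le hwle (by positivity)).trans (le_of_eq ?_)
        rw [Real.div_rpow (by positivity) (by positivity), ← Real.rpow_mul hP.le,
          div_mul_div_cancel₀ hα0.ne', div_self two_ne_zero, Real.rpow_one, ← Real.rpow_natCast ε 2,
          ← Real.rpow_mul hε.le]
        congr 2
        push_cast
        field_simp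
      have hkey : 11 * w ^ (α / 2) ≤ N * w * κ ^ α := by
        have h3 : N * w * κ ^ α = 2601 * 5 / 22 * (ε ^ α / (α * Real.log (d + 1))) := by
          rw [hκα, hw, ha]
          field_simp
        have h4 : 0 ≤ ε ^ α / (α * Real.log (d + 1)) := by positivity
        rw [h3]
        linarith
      have := rpow_div_le_of_two_le h2 (abs_nonneg D) hκ0 hw0 hDw hkey
      rw [sq_abs] at this
      linarith
  calc minimalDiscrepancy (psiNorm α) N d ≤ psiNorm α d (localDiscrepancy x) :=
        iInf_le_of_le x (iInf_le_of_le hinj (iInf_le _ hmem))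
    _ ≤ ENNReal.ofReal ε * ENNReal.ofReal (a ^ (1 / α)) := by
        rw [← ENNReal.ofReal_mul hε.le]; exact hbound
    _ ≤ _ := mul_le_mul_right (ofReal_le_psiNorm_emptyLocalDiscrepancy hα hd) _

/-! ### The inverse of the discrepancy and tractability -/

/-- The last factor of `constC` is at least 1 because e^{11/6} ≤ 2π, checked through e^11 ≤ 6.28^6.
The argument thus gives the slightly better constant on the left. -/
theorem le_constC {α : ℝ} (hα : 1 ≤ α) : 2601 * α ^ (2 / α) ≤ constC α := by
  rw [constC]
  refine le_mul_of_one_le_right (by positivity) (Real.one_le_rpow ?_ (by positivity))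
  rw [one_le_div (Real.exp_pos _)]
  refine Real.le_sqrt_of_sq_le ?_
  rw [← Real.exp_nat_mul]
  have h1 : Real.exp ((2 : ℕ) * (11 / 12)) ^ 6 = Real.exp 1 ^ 11 := by
    rw [← Real.exp_nat_mul, ← Real.exp_nat_mul]
    norm_num
  have h2 : Real.exp 1 ^ 11 ≤ (6.28 : ℝ) ^ 6 :=
    (pow_le_pow_left₀ (Real.exp_pos _).le Real.exp_one_lt_d9.le 11).trans (by norm_num)
  rw [← h1] at h2
  have h3 := le_of_pow_le_pow_left₀ (by norm_num : 6 ≠ 0) (by norm_num) h2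
  linarith [Real.pi_gt_d2]

theorem inverseDiscrepancy_psiNorm_le {α : ℝ} (hα : 1 ≤ α) {ε : ℝ} (hε : 0 < ε) {d : ℕ}
    (hd : 1 ≤ d) :
    inverseDiscrepancy (psiNorm α) ε d
      ≤ ((⌈constC α * (d : ℝ) ^ max 1 (2 / α) * Real.log ((d : ℝ) + 1) ^ (2 / α)
        * ε ^ (-2 : ℤ)⌉₊ : ℕ) : ℕ∞) := by
  have hd' : (1 : ℝ) ≤ d := by exact_mod_cast hd
  have hlog : 0 < Real.log ((d : ℝ) + 1) := Real.log_pos (by linarith)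
  have hC : 0 < constC α := lt_of_lt_of_le (by positivity) (le_constC hα)
  set X := constC α * (d : ℝ) ^ max 1 (2 / α) * Real.log ((d : ℝ) + 1) ^ (2 / α) * ε ^ (-2 : ℤ)
    with hX
  have hX0 : 0 < X := by positivity
  refine iInf_le_of_le ⌈X⌉₊ (iInf_le_of_le (Nat.one_le_ceil_iff.2 hX0) (iInf_le_of_le ?_ le_rfl))
  refine minimalDiscrepancy_psiNorm_le hα hε hd ?_
  have h1 : X * ε ^ 2
      = constC α * (d : ℝ) ^ max 1 (2 / α) * Real.log ((d : ℝ) + 1) ^ (2 / α) := by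
    rw [hX, zpow_neg, mul_assoc, show ε ^ (2 : ℤ) = ε ^ 2 from zpow_ofNat ε 2,
      inv_mul_cancel₀ (by positivity), mul_one]
  calc _ ≤ constC α * (d : ℝ) ^ max 1 (2 / α) * Real.log ((d : ℝ) + 1) ^ (2 / α) := by
        gcongr
        exact le_constC hα
    _ = X * ε ^ 2 := h1.symm
    _ ≤ _ := by gcongr; exact Nat.le_ceil X

theorem isAdmissibleExponent_psiNorm {α : ℝ} (hα : 1 ≤ α) {τ : ℝ} (hτ : max 1 (2 / α) < τ) :
    IsAdmissibleExponent (psiNorm α) τ := by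
  have hα0 : 0 < α := by linarith
  set m := max 1 (2 / α) with hm
  have hδ : 0 < τ - m := by linarith
  have hC : 0 < constC α := lt_of_lt_of_le (by positivity) (le_constC hα)
  -- Chosen so that (d+1)^η raised to the power 2/α is (d+1)^(τ-m); the surplus τ - m absorbs the
  -- logarithm. The `+ 1` in the constant below pays for the ceiling.
  set η := (τ - m) * α / 2 with hη
  have hη0 : 0 < η := by positivity
  refine ⟨constC α * (2 ^ (τ - m) / η ^ (2 / α)) + 1, by positivity, 2, by norm_num,
    fun ε hε hε1 d hd => ?_⟩
  have hd' : (1 : ℝ) ≤ d := by exact_mod_cast hd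
  have hd0 : (0 : ℝ) < d := by linarith
  have hlog : 0 < Real.log ((d : ℝ) + 1) := Real.log_pos (by linarith)
  have hinv := inverseDiscrepancy_psiNorm_le hα hε hd
  set X := constC α * (d : ℝ) ^ m * Real.log ((d : ℝ) + 1) ^ (2 / α) * ε ^ (-2 : ℤ) with hX
  have hX0 : 0 < X := by positivity
  refine (ENat.toENNReal_le.2 hinv).trans ?_
  rw [ENat.toENNReal_coe, ← ENNReal.ofReal_natCast]
  refine ENNReal.ofReal_le_ofReal ((Nat.ceil_lt_add_one hX0.le).le.trans ?_)
  have hε2 : ε ^ (-(2 : ℝ)) = ε ^ (-2 : ℤ) := by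
    rw [← Real.rpow_intCast]; norm_num
  have hlogle : Real.log ((d : ℝ) + 1) ^ (2 / α) ≤ 2 ^ (τ - m) / η ^ (2 / α) * (d : ℝ) ^ (τ - m) := by
    have h1 := Real.log_le_rpow_div (x := (d : ℝ) + 1) (by linarith) hη0
    calc _ ≤ (((d : ℝ) + 1) ^ η / η) ^ (2 / α) := Real.rpow_le_rpow hlog.le h1 (by positivity)
      _ = ((d : ℝ) + 1) ^ (τ - m) / η ^ (2 / α) := by
        rw [Real.div_rpow (by positivity) hη0.le, ← Real.rpow_mul (by positivity), hη]
        congr 2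
        field_simp
      _ ≤ (2 * (d : ℝ)) ^ (τ - m) / η ^ (2 / α) := by
        gcongr
        linarith
      _ = _ := by rw [Real.mul_rpow (by norm_num) hd0.le]; ring
  have hτm : (d : ℝ) ^ τ = (d : ℝ) ^ m * (d : ℝ) ^ (τ - m) := by
    rw [← Real.rpow_add hd0]; ring_nf
  have hone : 1 ≤ (d : ℝ) ^ τ * ε ^ (-2 : ℤ) := by
    refine one_le_mul_of_one_le_of_one_le (Real.one_le_rpow hd' ?_) ?_
    · exact (le_trans (le_max_left _ _ |>.trans' zero_le_one) hτ.le)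
    · rw [zpow_neg, show ε ^ (2 : ℤ) = ε ^ 2 from zpow_ofNat ε 2]
      exact (one_le_inv₀ (by positivity)).2 (pow_le_one₀ hε.le hε1.le)
  rw [hε2, add_mul, add_mul, one_mul]
  refine add_le_add ?_ hone
  calc X ≤ constC α * (d : ℝ) ^ m * (2 ^ (τ - m) / η ^ (2 / α) * (d : ℝ) ^ (τ - m))
        * ε ^ (-2 : ℤ) := by rw [hX]; gcongr
    _ = _ := by rw [hτm]; ring

theorem dExponent_psiNorm_le {α : ℝ} (hα : 1 ≤ α) :
    dExponent (psiNorm α) ≤ ENNReal.ofReal (max 1 (2 / α)) := by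
  have hm : 0 ≤ max 1 (2 / α) := zero_le_one.trans (le_max_left _ _)
  refine ENNReal.le_of_forall_pos_le_add fun δ hδ _ => ?_
  have hδ' : (0 : ℝ) < δ := hδ
  have hτ : max 1 (2 / α) < max 1 (2 / α) + δ := by linarith
  refine (iInf_le_of_le (max 1 (2 / α) + δ) (iInf_le_of_le (add_pos_of_nonneg_of_pos hm hδ')
    (iInf_le _ (isAdmissibleExponent_psiNorm hα hτ)))).trans (le_of_eq ?_)
  rw [ENNReal.ofReal_add hm hδ'.le, ENNReal.ofReal_coe_nnreal]

theorem isPolynomiallyTractable_psiNorm {α : ℝ} (hα : 1 ≤ α) :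
    IsPolynomiallyTractable (psiNorm α) :=
  ⟨max 1 (2 / α) + 1, add_pos_of_pos_of_nonneg (zero_lt_one.trans_le (le_max_left _ _)) zero_le_one,
    isAdmissibleExponent_psiNorm hα (lt_add_one _)⟩

end OrliczDiscrepancy

theorem theorem2 (α : ℝ) (hα : 1 ≤ α) :
    (∀ ε : ℝ, 0 < ε → ε < 1 → ∀ d : ℕ, 1 ≤ d →
      OrliczDiscrepancy.inverseDiscrepancy (OrliczDiscrepancy.psiNorm α) ε d
        ≤ ((⌈OrliczDiscrepancy.constC α * (d : ℝ) ^ max 1 (2 / α)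
              * Real.log ((d : ℝ) + 1) ^ (2 / α) * ε ^ (-2 : ℤ)⌉₊ : ℕ) : ℕ∞)) ∧
    OrliczDiscrepancy.IsPolynomiallyTractable (OrliczDiscrepancy.psiNorm α) ∧
    OrliczDiscrepancy.dExponent (OrliczDiscrepancy.psiNorm α)
      ≤ ENNReal.ofReal (max 1 (2 / α)) :=
  ⟨fun _ hε _ _ hd => OrliczDiscrepancy.inverseDiscrepancy_psiNorm_le hα hε hd,
    OrliczDiscrepancy.isPolynomiallyTractable_psiNorm hα,
    OrliczDiscrepancy.dExponent_psiNorm_le hα⟩
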